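/- **Conventions.** A plot of a diffeological space $X$ is a map from $\mathbb R^n$ (any $n\ge 0$) to $X$ that belongs to its diffeology. Subsets carry the subset diffeology. The pushforward diffeology along a map is the finest one that makes the map smooth. *Forms.* A differential $1$-form $\omega\in\Omega^1(X)$ assigns to each plot $p:\mathbb R^n\to X$ a smooth $1$-form $\omega(p)$ on $\mathbb R^n$ with $\omega(p\circ h)=h^*\omega(p)$ for all smooth $h:\mathbb R^m\to\mathbb R^n$. $\Omega^1(X)$ carries its functional diffeology: $u\mapsto\omega_u$ is a plot iff $(u,t)\mapsto\omega_u(p)(t)$ is smooth for every plot $p$ of $X$. Put $\Omega^1_x(X)=\{\omega : \omega(p)(0)=0\text{ for all plots }p\text{ with }p(0)=x\}$, $\Lambda^1_x(X)=\Omega^1(X)/\Omega^1_x(X)$ and $\Lambda^1(X)=\bigsqcup_x\Lambda^1_x(X)$, with the pushforward diffeology along $X\times\Omega^1(X)\to\Lambda^1(X)$, $(x,\omega)\mapsto\omega+\Omega^1_x(X)$. *Pseudo-bundles.* A diffeological vector pseudo-bundle $V\to X$ is a diffeological space with a smooth projection to $X$ and real vector space structures on the fibres, such that fibrewise addition $V\times_XV\to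 V$, scalar multiplication $\mathbb R\times V\to V$ and the zero section are smooth. If the fibres are finite-dimensional, a pseudo-metric on $V$ is a family $g$ of symmetric positive semidefinite bilinear forms $g(x)$ on $V_x$ such that $g(b(t))(v(t),w(t))$ is smooth in $t$ for all plots $v,w$ of $V$ over the same plot $b$ of $X$, and such that $\dim\ker g(x)=\dim V_x-\dim V_x^*$ for all $x$, where $V_x^*$ is the space of smooth linear functionals on $V_x$. $C\ell(V,g)$ is the family of the Clifford algebras $C\ell(V_x,g(x))$, with relations $vw+wv=-2g(x)(v,w)$, with the quotient of the diffeology of the pseudo-bundle $\bigoplus_rV^{\otimes r}$ of tensor algebras: its plots are locally the finite sums $\sum_ia_iv_{i1}\cdots v_{ir_i}$ with smooth real functions $a_i$ and plots $v_{ij}$ of $V$, all over one plot of $X$. A pseudo-bundle of Clifford modules over $C\ell(V,g)$ with Clifford action $c$ is a pseudo-bundle $\chi:E\to X$ with unital algebra homomorphisms $c_x:C\ell(V_x,g(x))\to\mathrm{End}(E_x)$ with values in smooth endomorphisms that form a smooth map $C\ell(V,g)\to\mathcal L(E,E)$; here $\mathcal L(E,E)$ has the functional diffeology, in which $\phi$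 is a plot iff it lies over a plot of $X$ and, for every plot $q$ of $E$, the map $(t,s)\mapsto\phi(t)(q(s))$ is smooth on the set of all $(t,s)$ such that $\phi(t)$ and $q(s)$ lie over the same point. *Gluing.* Let $X_1,X_2$ be diffeological spaces, $Y\subseteq X_1$, and let $f:Y\to X_2$ be a diffeomorphism onto its image. $X_1\cup_fX_2$ is the quotient of $X_1\sqcup X_2$ by the equivalence relation generated by $y\sim f(y)$, with the quotient diffeology; $\tilde i_1:X_1\to X_1\cup_fX_2$ and $i_2:X_2\to X_1\cup_fX_2$ are the natural maps. As a set it is the disjoint union of $\tilde i_1(X_1\setminus Y)$, $i_2(f(Y))$ and $i_2(X_2\setminus f(Y))$. Pullback of forms along $\tilde i_1$ and $i_2$ induces linear maps $\tilde\rho_1^\Lambda:\Lambda^1_{\tilde i_1(x)}(X_1\cup_fX_2)\to\Lambda^1_x(X_1)$ for $x\in X_1$ and $\tilde\rho_2^\Lambda:\Lambda^1_{i_2(x)}(X_1\cup_fX_2)\to\Lambda^1_x(X_2)$ for $x\in X_2$. Forms $\omega_1\in\Omega^1(X_1)$ and $\omega_2\in\Omega^1(X_2)$ are compatible if $\omega_1|_Y=f^*\omega_2$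 in $\Omega^1(Y)$. Elements $\alpha_1\in\Lambda^1_y(X_1)$ and $\alpha_2\in\Lambda^1_{f(y)}(X_2)$, $y\in Y$, are compatible if they are the classes of some pair of compatible forms. Pseudo-metrics $g_1^\Lambda$ on $\Lambda^1(X_1)$ and $g_2^\Lambda$ on $\Lambda^1(X_2)$ are compatible if $g_1^\Lambda(y)(\alpha_1,\beta_1)=g_2^\Lambda(f(y))(\alpha_2,\beta_2)$ for all $y\in Y$ and all compatible pairs $(\alpha_1,\alpha_2)$ and $(\beta_1,\beta_2)$ over $y$. Then $g^\Lambda$ on $\Lambda^1(X_1\cup_fX_2)$ is defined by $$g^\Lambda(z)(\alpha,\beta)=\begin{cases}g_1^\Lambda(x)(\tilde\rho_1^\Lambda\alpha,\tilde\rho_1^\Lambda\beta), & z=\tilde i_1(x),\ x\in X_1\setminus Y,\\ \tfrac12\left(g_1^\Lambda(y)(\tilde\rho_1^\Lambda\alpha,\tilde\rho_1^\Lambda\beta)+g_2^\Lambda(f(y))(\tilde\rho_2^\Lambda\alpha,\tilde\rho_2^\Lambda\beta)\right), & z=i_2(f(y)),\ y\in Y,\\ g_2^\Lambda(x)(\tilde\rho_2^\Lambda\alpha,\tilde\rho_2^\Lambda\beta),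 & z=i_2(x),\ x\in X_2\setminus f(Y).\end{cases}$$ **Theorem.** Let $X_1,X_2$ be diffeological spaces such that all fibres of $\Lambda^1(X_1)$ and $\Lambda^1(X_2)$ are finite-dimensional, and let $f:X_1\supseteq Y\to X_2$ be a diffeomorphism onto its image such that $\mathcal D_1^\Omega=\mathcal D_2^\Omega$, where $\mathcal D_1^\Omega$ and $\mathcal D_2^\Omega$ are the pushforward diffeologies on $\Omega^1(Y)$ along the restriction $\Omega^1(X_1)\to\Omega^1(Y)$ and along $f^*:\Omega^1(X_2)\to\Omega^1(Y)$. Let $g_1^\Lambda,g_2^\Lambda$ be compatible pseudo-metrics on $\Lambda^1(X_1),\Lambda^1(X_2)$. For $i=1,2$ let $\chi_i:E_i\to X_i$ be a pseudo-bundle of Clifford modules over $C\ell(\Lambda^1(X_i),g_i^\Lambda)$ with Clifford action $c_i$. Let $\tilde f':\chi_1^{-1}(Y)\to E_2$ be a fibrewise linear diffeomorphism onto its image that covers $f$, let $E_1\cup_{\tilde f'}E_2$ be the quotient of $E_1\sqcup E_2$ by the equivalence relation generated by $e\sim\tilde f'(e)$, with the quotient diffeology, and let $\tilde j_1:E_1\to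 E_1\cup_{\tilde f'}E_2$ and $j_2:E_2\to E_1\cup_{\tilde f'}E_2$ be the natural maps. Suppose that $c_1$ and $c_2$ are compatible: $$c_2(\tilde\rho_2^\Lambda\alpha)(\tilde f'(e))=\tilde f'\left(c_1(\tilde\rho_1^\Lambda\alpha)(e)\right)\qquad\text{for all }y\in Y,\ \alpha\in\Lambda^1_{i_2(f(y))}(X_1\cup_fX_2),\ e\in\chi_1^{-1}(y).$$ Let the induced action $\tilde c(\alpha)$ of $\alpha\in\Lambda^1_z(X_1\cup_fX_2)$ on the fibre of $E_1\cup_{\tilde f'}E_2$ over $z$ be given by $\tilde c(\alpha)(\tilde j_1(e))=\tilde j_1\left(c_1(\tilde\rho_1^\Lambda\alpha)(e)\right)$ if $z\in\tilde i_1(X_1\setminus Y)$ and by $\tilde c(\alpha)(j_2(e))=j_2\left(c_2(\tilde\rho_2^\Lambda\alpha)(e)\right)$ if $z\in i_2(X_2)$. Then: 1. $g^\Lambda$ is a pseudo-metric on $\Lambda^1(X_1\cup_fX_2)$; 2. $\tilde c$ does not depend on the representative used to compute it: $\tilde c(\alpha)(\tilde j_1(e))=\tilde j_1\left(c_1(\tilde\rho_1^\Lambda\alpha)(e)\right)$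 for all $x\in X_1$ (also for $x\in Y$), $e\in\chi_1^{-1}(x)$ and $\alpha$ over $\tilde i_1(x)$, and $\tilde c(\alpha)(j_2(e))=j_2\left(c_2(\tilde\rho_2^\Lambda\alpha)(e)\right)$ for all $x\in X_2$, $e\in\chi_2^{-1}(x)$ and $\alpha$ over $i_2(x)$; 3. $\tilde c$ extends, in exactly one way, to a family of unital algebra homomorphisms from the Clifford algebras $C\ell(\Lambda^1_z(X_1\cup_fX_2),g^\Lambda(z))$ to the endomorphism algebras of the fibres of $E_1\cup_{\tilde f'}E_2$, and with this smooth Clifford action $E_1\cup_{\tilde f'}E_2$ is a pseudo-bundle of Clifford modules over $C\ell(\Lambda^1(X_1\cup_fX_2),g^\Lambda)$. -/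

import Mathlib

open scoped ContDiff Topology
open Diffeology

universe u₁ u₂ v

noncomputable section

namespace DiffGluing

/-! Diffeological spaces, plots (`IsPlot`) and smooth maps (`DSmooth`) are Mathlib's. There a
diffeology is given by its plots with domain a full space `ℝⁿ`; by locality these determine the
plots on all open subsets. -/

/-- The domains of plots. -/
abbrev Euc (n : ℕ) : Type := EuclideanSpace ℝ (Fin n)

section Constructions

variable {A B : Type*}

/-- The pullback diffeology: the coarsest one for which `f` is smooth. -/
@[reducible] def pullbackDiffeology [DiffeologicalSpace B] (f : A → B) :
    DiffeologicalSpace A where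
  plots n := {p : Euc n → A | IsPlot (f ∘ p)}
  constant_plots x := isPlot_const (x := f x)
  plot_reparam hp hf := isPlot_reparam hp hf
  locality hp := DiffeologicalSpace.locality fun x ↦ by
    obtain ⟨u, hu, hxu, h⟩ := hp x
    exact ⟨u, hu, hxu, fun hfu hf ↦ h hfu hf⟩

/-- The pushforward diffeology: the finest one for which `f` is smooth. -/
@[reducible] def pushforwardDiffeology [DiffeologicalSpace A] (f : A → B) :
    DiffeologicalSpace B :=
  DiffeologicalSpace.generateFrom {p | ∃ q : Euc p.1 → A, IsPlot q ∧ p.2 = f ∘ q}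

/-- Every subset carries the subset diffeology. -/
instance subsetDiffeology [DiffeologicalSpace A] (S : Set A) : DiffeologicalSpace S :=
  pullbackDiffeology (Subtype.val : S → A)

theorem smooth_val [DiffeologicalSpace A] (S : Set A) : DSmooth (Subtype.val : S → A) :=
  fun _ _ hp ↦ hp

/-- `f` is a diffeomorphism of its domain onto its image (with the subset diffeology). -/
def IsDiffeoOntoImage [DiffeologicalSpace A] [DiffeologicalSpace B] (f : A → B) : Prop :=
  ∃ e : A ≃ Set.range f, (∀ a, (e a : B) = f a) ∧ DSmooth e ∧ DSmooth e.symm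

theorem IsDiffeoOntoImage.smooth [DiffeologicalSpace A] [DiffeologicalSpace B] {f : A → B}
    (hf : IsDiffeoOntoImage f) : DSmooth f := by
  obtain ⟨e, he, hs, -⟩ := hf
  have : f = Subtype.val ∘ e := funext fun a ↦ (he a).symm
  rw [this]
  exact (smooth_val _).comp hs

/-- A smooth map of `ℝⁿ` into a neighbourhood of a point which is the identity near that point. -/
theorem exists_retraction {n : ℕ} {u : Set (Euc n)} (hu : IsOpen u) {x : Euc n} (hx : x ∈ u) :
    ∃ r : Euc n → Euc n, ContDiff ℝ ∞ r ∧ (∀ z, r z ∈ u) ∧ ∀ᶠ z in 𝓝 x, r z = z := by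
  obtain ⟨ε, hε, hsub⟩ := Metric.isOpen_iff.1 hu x hx
  let b : ContDiffBump x := ⟨ε / 2, ε, by positivity, by linarith⟩
  refine ⟨fun z ↦ x + b z • (z - x), ?_, fun z ↦ hsub ?_, ?_⟩
  · exact contDiff_const.add (b.contDiff.smul (contDiff_id.sub contDiff_const))
  · rw [Metric.mem_ball, dist_eq_norm, add_sub_cancel_left, norm_smul]
    by_cases hz : z ∈ Metric.ball x ε
    · have h1 : ‖b z‖ ≤ 1 := by
        rw [Real.norm_of_nonneg b.nonneg]; exact b.le_one
      have h2 : ‖z - x‖ < ε := by rwa [← dist_eq_norm]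
      calc ‖b z‖ * ‖z - x‖ ≤ 1 * ‖z - x‖ := by gcongr
        _ < ε := by simpa using h2
    · have : b z = 0 := b.zero_of_le_dist (by simpa using hz)
      simpa [this] using hε
  · filter_upwards [b.eventuallyEq_one] with z hz
    simp [hz]

end Constructions

/-! ### Differential 1-forms -/

section Forms

variable {X X' : Type*} [DiffeologicalSpace X] [DiffeologicalSpace X']

/-- Families of (arbitrary) 1-forms on `ℝⁿ`, indexed by the plots `ℝⁿ → X`. -/
def FormData (X : Type*) [DiffeologicalSpace X] : Type _ :=
  ∀ n : ℕ, {p : Euc n → X // IsPlot p} → Euc n → (Euc n →L[ℝ] ℝ)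

instance : AddCommGroup (FormData X) :=
  inferInstanceAs (AddCommGroup (∀ n : ℕ, {p : Euc n → X // IsPlot p} → Euc n → (Euc n →L[ℝ] ℝ)))

instance : Module ℝ (FormData X) :=
  inferInstanceAs (Module ℝ (∀ n : ℕ, {p : Euc n → X // IsPlot p} → Euc n → (Euc n →L[ℝ] ℝ)))

/-- `Ω¹(X)`: a 1-form assigns to every plot `p` a smooth 1-form on the domain of `p`, such that
`α(p ∘ g) = g^*(α(p))` for every smooth map `g`. -/
def OneForm (X : Type*) [DiffeologicalSpace X] : Submodule ℝ (FormData X) where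
  carrier := {α | (∀ n p, ContDiff ℝ ∞ (α n p)) ∧
    ∀ (m n : ℕ) (p : {p : Euc n → X // IsPlot p}) (g : Euc m → Euc n) (hg : ContDiff ℝ ∞ g)
      (t : Euc m), α m ⟨p.1 ∘ g, isPlot_reparam p.2 hg⟩ t = (α n p (g t)).comp (fderiv ℝ g t)}
  zero_mem' := ⟨fun _ _ ↦ contDiff_const, fun _ _ _ _ _ _ ↦
    (ContinuousLinearMap.zero_comp _).symm⟩
  add_mem' ha hb := ⟨fun n p ↦ (ha.1 n p).add (hb.1 n p), fun m n p g hg t ↦ by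
    exact (congrArg₂ (· + ·) (ha.2 m n p g hg t) (hb.2 m n p g hg t)).trans
      (ContinuousLinearMap.add_comp _ _ _).symm⟩
  smul_mem' c _ ha := ⟨fun n p ↦ (ha.1 n p).const_smul c, fun m n p g hg t ↦ by
    exact (congrArg (c • ·) (ha.2 m n p g hg t)).trans (ContinuousLinearMap.smul_comp _ _ _).symm⟩

/-- The functional diffeology of `Ω¹(X)`: `φ` is a plot iff `(s, t) ↦ φ(s)(p)(t)` is smooth for
every plot `p` of `X`. -/
instance oneFormDiffeology : DiffeologicalSpace (OneForm X) where
  plots m := {φ : Euc m → OneForm X | ∀ (n : ℕ) (p : {p : Euc n → X // IsPlot p}),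
    ContDiff ℝ ∞ (fun s : Euc m × Euc n ↦ (φ s.1).1 n p s.2)}
  constant_plots α := fun n p ↦ (α.2.1 n p).comp contDiff_snd
  plot_reparam hp hf := fun n p ↦
    (hp n p).comp ((hf.comp contDiff_fst).prodMk contDiff_snd)
  locality {m φ} hφ := fun n p ↦ by
    rw [contDiff_iff_contDiffAt]
    rintro ⟨s, t⟩
    obtain ⟨u, hu, hsu, h⟩ := hφ s
    obtain ⟨r, hr, hru, hrs⟩ := exists_retraction hu hsu
    refine ((h hru hr) n p).contDiffAt.congr_of_eventuallyEq ?_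
    have : ∀ᶠ z : Euc m × Euc n in 𝓝 (s, t), r z.1 = z.1 := by
      rw [nhds_prod_eq]; exact hrs.prod_inl _
    filter_upwards [this] with z hz
    simp [hz]

/-- The pullback `φ^* : Ω¹(X') → Ω¹(X)` along a smooth map, `(φ^*α)(p) = α(φ ∘ p)`. -/
def OneForm.pullback (φ : X → X') (hφ : DSmooth φ) : OneForm X' →ₗ[ℝ] OneForm X where
  toFun α := ⟨fun n p ↦ α.1 n ⟨φ ∘ p.1, hφ n p.1 p.2⟩,
    fun n p ↦ α.2.1 n ⟨φ ∘ p.1, hφ n p.1 p.2⟩,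
    fun m n p g hg t ↦ α.2.2 m n ⟨φ ∘ p.1, hφ n p.1 p.2⟩ g hg t⟩
  map_add' _ _ := rfl
  map_smul' _ _ := rfl

/-- `Ω¹_x(X)`: the 1-forms vanishing at `x`, i.e. `α(p)(0) = 0` for all plots `p` with
`p(0) = x`. -/
def vanishingAt (X : Type*) [DiffeologicalSpace X] (x : X) : Submodule ℝ (OneForm X) where
  carrier := {α | ∀ (n : ℕ) (p : {p : Euc n → X // IsPlot p}), p.1 0 = x → α.1 n p 0 = 0}
  zero_mem' := fun _ _ _ ↦ rfl
  add_mem' ha hb := fun n p h ↦ by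
    exact (congrArg₂ (· + ·) (ha n p h) (hb n p h)).trans (add_zero 0)
  smul_mem' c _ ha := fun n p h ↦ by
    exact (congrArg (c • ·) (ha n p h)).trans (smul_zero c)

/-- The fibre `Λ¹_x(X) = Ω¹(X) / Ω¹_x(X)`. -/
def Lam (X : Type*) [DiffeologicalSpace X] (x : X) : Type _ := OneForm X ⧸ vanishingAt X x

instance (x : X) : AddCommGroup (Lam X x) :=
  inferInstanceAs (AddCommGroup (OneForm X ⧸ vanishingAt X x))

instance (x : X) : Module ℝ (Lam X x) :=
  inferInstanceAs (Module ℝ (OneForm X ⧸ vanishingAt X x))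

/-- The value `α_x` of the form `α` at `x`. -/
def valueAt (x : X) : OneForm X →ₗ[ℝ] Lam X x := (vanishingAt X x).mkQ

/-- The diffeology of the total space `Λ¹(X)`: the pushforward of the product diffeology by
`X × Ω¹(X) → Λ¹(X)`, `(x, α) ↦ (x, α_x)`; plots of the product are pairs of plots. -/
instance lamDiffeology : DiffeologicalSpace (Σ x, Lam X x) :=
  DiffeologicalSpace.generateFrom
    {p | ∃ (b : Euc p.1 → X) (η : Euc p.1 → OneForm X), IsPlot b ∧ IsPlot η ∧
      p.2 = fun t ↦ ⟨b t, valueAt (b t) (η t)⟩}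

/-- The map `Λ¹_{x'}(X') → Λ¹_x(X)` induced by pullback along a smooth map with `φ x = x'`. -/
def lamPullback (φ : X → X') (hφ : DSmooth φ) {x : X} {x' : X'} (h : φ x = x') :
    Lam X' x' →ₗ[ℝ] Lam X x :=
  Submodule.mapQ (vanishingAt X' x') (vanishingAt X x) (OneForm.pullback φ hφ)
    (fun _ hα n p hp ↦ hα n ⟨φ ∘ p.1, hφ n p.1 p.2⟩ (by simp [hp, h]))

end Forms

/-! ### Diffeological vector pseudo-bundles

A pseudo-bundle over `X` is given by the family `V` of its fibres and a diffeology on its total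
space `Σ x, V x`. -/

section Bundles

variable {X : Type*} [DiffeologicalSpace X]

/-- `Σ x, V x → X` is a diffeological vector pseudo-bundle: the projection, the addition
`V ×_X V → V`, the scalar multiplication `ℝ × V → V` and the zero section are smooth. -/
structure IsPseudoBundle (V : X → Type*) [∀ x, AddCommGroup (V x)] [∀ x, Module ℝ (V x)]
    [DiffeologicalSpace (Σ x, V x)] : Prop where
  proj : DSmooth (fun w : Σ x, V x ↦ w.1)
  add : ∀ (n : ℕ) (b : Euc n → X) (w w' : ∀ t, V (b t)),
    IsPlot (fun t ↦ (⟨b t, w t⟩ : Σ x, V x)) → IsPlot (fun t ↦ (⟨b t, w' t⟩ : Σ x, V x)) →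
    IsPlot (fun t ↦ (⟨b t, w t + w' t⟩ : Σ x, V x))
  smul : ∀ (n : ℕ) (b : Euc n → X) (a : Euc n → ℝ) (w : ∀ t, V (b t)),
    IsPlot a → IsPlot (fun t ↦ (⟨b t, w t⟩ : Σ x, V x)) →
    IsPlot (fun t ↦ (⟨b t, a t • w t⟩ : Σ x, V x))
  zero : DSmooth (fun x : X ↦ (⟨x, 0⟩ : Σ x, V x))

/-- The subset diffeology on a fibre. -/
@[reducible] def fibreDiffeology (V : X → Type*) [DiffeologicalSpace (Σ x, V x)] (x : X) :
    DiffeologicalSpace (V x) :=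
  pullbackDiffeology (fun w : V x ↦ (⟨x, w⟩ : Σ x, V x))

/-- The diffeological dual of a fibre: its smooth linear functionals. -/
def smoothDual (V : X → Type*) [∀ x, AddCommGroup (V x)] [∀ x, Module ℝ (V x)]
    [DiffeologicalSpace (Σ x, V x)] (x : X) : Submodule ℝ (Module.Dual ℝ (V x)) where
  carrier := {l | @DSmooth (V x) ℝ (fibreDiffeology V x) _ l}
  zero_mem' := fun _ _ _ ↦ isPlot_const (x := (0 : ℝ))
  add_mem' ha hb := fun n p hp ↦ ((ha n p hp).contDiff.add (hb n p hp).contDiff).isPlot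
  smul_mem' c _ ha := fun n p hp ↦ ((ha n p hp).contDiff.const_smul c).isPlot

/-- `g` is a pseudo-metric on a pseudo-bundle with finite-dimensional fibres: a smooth family of
symmetric positive semidefinite forms `g(x)` on the fibres for which the multiplicity of the
eigenvalue `0` is `dim V_x - dim (V_x)^*`. Smoothness is tested by evaluating on plots. -/
structure IsPseudoMetric {V : X → Type*} [∀ x, AddCommGroup (V x)] [∀ x, Module ℝ (V x)]
    [DiffeologicalSpace (Σ x, V x)] (g : ∀ x, LinearMap.BilinForm ℝ (V x)) : Prop where
  smooth : ∀ (n : ℕ) (b : Euc n → X) (w w' : ∀ t, V (b t)),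
    IsPlot (fun t ↦ (⟨b t, w t⟩ : Σ x, V x)) → IsPlot (fun t ↦ (⟨b t, w' t⟩ : Σ x, V x)) →
    IsPlot (fun t ↦ g (b t) (w t) (w' t))
  symm : ∀ x w w', g x w w' = g x w' w
  nonneg : ∀ x w, 0 ≤ g x w w
  rank : ∀ x, Module.finrank ℝ (LinearMap.ker (g x)) + Module.finrank ℝ (smoothDual V x) =
    Module.finrank ℝ (V x)

/-! ### Clifford algebras and Clifford modules -/

/-- The fibre `Cl(V_x, g(x))`, with the relation `v w + w v = -2 g(v, w)`. -/
def Cl {V : X → Type*} [∀ x, AddCommGroup (V x)] [∀ x, Module ℝ (V x)]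
    (g : ∀ x, LinearMap.BilinForm ℝ (V x)) (x : X) : Type _ :=
  CliffordAlgebra (-(LinearMap.BilinMap.toQuadraticMap (g x)))

section

variable {V : X → Type*} [∀ x, AddCommGroup (V x)] [∀ x, Module ℝ (V x)]
  (g : ∀ x, LinearMap.BilinForm ℝ (V x))

instance (x : X) : Ring (Cl g x) :=
  inferInstanceAs (Ring (CliffordAlgebra (-(LinearMap.BilinMap.toQuadraticMap (g x)))))

instance (x : X) : Algebra ℝ (Cl g x) :=
  inferInstanceAs (Algebra ℝ (CliffordAlgebra (-(LinearMap.BilinMap.toQuadraticMap (g x)))))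

/-- The canonical map `V_x → Cl(V_x, g(x))`. -/
def toCl (x : X) : V x →ₗ[ℝ] Cl g x :=
  CliffordAlgebra.ι (-(LinearMap.BilinMap.toQuadraticMap (g x)))

/-- The diffeology of the pseudo-bundle of Clifford algebras, the quotient of the pseudo-bundle
`⨁ᵣ V^{⊗ r}` of tensor algebras: its plots are locally the finite sums
`∑ᵢ aᵢ vᵢ₁ ⋯ vᵢᵣ` with smooth real functions `aᵢ` and plots `vᵢⱼ` of `V`, all over one plot `b`
of the base. -/
instance clDiffeology [DiffeologicalSpace (Σ x, V x)] : DiffeologicalSpace (Σ x, Cl g x) :=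
  DiffeologicalSpace.generateFrom
    {p | ∃ (b : Euc p.1 → X) (k : ℕ) (a : Fin k → Euc p.1 → ℝ) (r : Fin k → ℕ)
      (w : ∀ i : Fin k, Fin (r i) → ∀ t, V (b t)),
      IsPlot b ∧ (∀ i, IsPlot (a i)) ∧
      (∀ i j, IsPlot (fun t ↦ (⟨b t, w i j t⟩ : Σ x, V x))) ∧
      p.2 = fun t ↦ ⟨b t, ∑ i, a i t • (List.ofFn fun j ↦ toCl g (b t) (w i j t)).prod⟩}

end

/-- The fibre of `ℒ(E, E)`: the smooth linear endomorphisms of `E_x`. -/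
def SmoothEnd (E : X → Type*) [∀ x, AddCommGroup (E x)] [∀ x, Module ℝ (E x)]
    [DiffeologicalSpace (Σ x, E x)] (x : X) : Type _ :=
  {φ : Module.End ℝ (E x) // @DSmooth _ _ (fibreDiffeology E x) (fibreDiffeology E x) φ}

/-- The functional diffeology of the pseudo-bundle `ℒ(E, E)`: `p` is a plot iff it lies over a
plot of `X` and `(t, s) ↦ p(t)(q(s))` is smooth, for every plot `q` of `E`, on the set of all
`(t, s)` for which `p(t)` and `q(s)` lie over the same point, with the subset diffeology
(below `u` and `e` stand for the two components of a plot of this set, the second one composed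
with `q`). -/
instance smoothEndDiffeology (E : X → Type*) [∀ x, AddCommGroup (E x)] [∀ x, Module ℝ (E x)]
    [DiffeologicalSpace (Σ x, E x)] : DiffeologicalSpace (Σ x, SmoothEnd E x) where
  plots n := {p : Euc n → Σ x, SmoothEnd E x | IsPlot (fun t ↦ (p t).1) ∧
    ∀ (k : ℕ) (u : Euc k → Euc n) (e : ∀ t, E (p (u t)).1), ContDiff ℝ ∞ u →
      IsPlot (fun t ↦ (⟨(p (u t)).1, e t⟩ : Σ x, E x)) →
      IsPlot (fun t ↦ (⟨(p (u t)).1, (p (u t)).2.1 (e t)⟩ : Σ x, E x))}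
  constant_plots φ := ⟨isPlot_const (x := φ.1), fun k _ e _ he ↦ φ.2.2 k e he⟩
  plot_reparam {n m p f} hp hf := ⟨isPlot_reparam hp.1 hf,
    fun k u e hu he ↦ hp.2 k (f ∘ u) e (hf.comp hu) he⟩
  locality {n p} hp := by
    refine ⟨DiffeologicalSpace.locality fun x ↦ ?_, fun k u e hu he ↦
      DiffeologicalSpace.locality fun x ↦ ?_⟩
    · obtain ⟨U, hU, hxU, h⟩ := hp x
      exact ⟨U, hU, hxU, fun hfU hf ↦ (h hfU hf).1⟩
    · obtain ⟨U, hU, hxU, h⟩ := hp (u x)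
      refine ⟨u ⁻¹' U, hU.preimage hu.continuous, hxU, fun {m f} hfU hf ↦ ?_⟩
      exact (h (f := u ∘ f) hfU (hu.comp hf)).2 m id (fun t ↦ e (f t)) contDiff_id
        (isPlot_reparam he hf)

/-- `E` is a pseudo-bundle of Clifford modules over `Cl(V, g)` with Clifford action `c`: a
diffeological vector pseudo-bundle with unital algebra homomorphisms
`c_x : Cl(V_x, g(x)) → End(E_x)` that form a smooth map `Cl(V, g) → ℒ(E, E)`. -/
structure IsCliffordModule {V : X → Type*} [∀ x, AddCommGroup (V x)] [∀ x, Module ℝ (V x)]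
    [DiffeologicalSpace (Σ x, V x)] (g : ∀ x, LinearMap.BilinForm ℝ (V x))
    {E : X → Type*} [∀ x, AddCommGroup (E x)] [∀ x, Module ℝ (E x)]
    [DiffeologicalSpace (Σ x, E x)] (c : ∀ x, Cl g x →ₐ[ℝ] Module.End ℝ (E x)) : Prop where
  pseudoBundle : IsPseudoBundle E
  smooth : ∃ h : ∀ x a, @DSmooth _ _ (fibreDiffeology E x) (fibreDiffeology E x) (c x a),
    DSmooth (fun a : Σ x, Cl g x ↦ (⟨a.1, ⟨c a.1 a.2, h a.1 a.2⟩⟩ : Σ x, SmoothEnd E x))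

end Bundles

/-! ### Gluing of spaces -/

section Gluing

variable {X₁ : Type u₁} {X₂ : Type u₂} {Y : Set X₁}

/-- The set `X₁ ∪_f X₂`, the quotient of `X₁ ⊔ X₂` by the relation generated by `y ∼ f(y)`, in
its canonical form `(X₁ ∖ Y) ⊔ X₂`; see `glue_surjective` and `glue_eq_iff`. -/
inductive Glue (f : Y → X₂) : Type (max u₁ u₂)
  | left : {x : X₁ // x ∉ Y} → Glue f
  | right : X₂ → Glue f

variable (f : Y → X₂)

open Classical in
/-- The map `ĩ₁ : X₁ → X₁ ∪_f X₂`. -/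
def inc₁ (x : X₁) : Glue f := if h : x ∈ Y then .right (f ⟨x, h⟩) else .left ⟨x, h⟩

/-- The map `i₂ : X₂ → X₁ ∪_f X₂`. -/
def inc₂ (x : X₂) : Glue f := .right x

theorem inc₁_mem (y : Y) : inc₁ f y = inc₂ f (f y) := by simp [inc₁, inc₂]

theorem inc₁_notMem (x : {x : X₁ // x ∉ Y}) : inc₁ f x = Glue.left x := by
  simp [inc₁, x.2]

theorem glue_surjective : Function.Surjective (Sum.elim (inc₁ f) (inc₂ f)) := by
  rintro (x | x)
  · exact ⟨Sum.inl x.1, inc₁_notMem f x⟩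
  · exact ⟨Sum.inr x, rfl⟩

theorem glue_eq_iff (a b : X₁ ⊕ X₂) :
    Sum.elim (inc₁ f) (inc₂ f) a = Sum.elim (inc₁ f) (inc₂ f) b ↔
      Relation.EqvGen (fun s t ↦ ∃ y : Y, s = Sum.inl y.1 ∧ t = Sum.inr (f y)) a b := by
  constructor
  · let back : Glue f → X₁ ⊕ X₂
      | .left x => Sum.inl x.1
      | .right x => Sum.inr x
    have key : ∀ s : X₁ ⊕ X₂, Relation.EqvGen
        (fun s t ↦ ∃ y : Y, s = Sum.inl y.1 ∧ t = Sum.inr (f y)) s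
        (back (Sum.elim (inc₁ f) (inc₂ f) s)) := by
      rintro (x | x)
      · by_cases h : x ∈ Y
        · have := inc₁_mem f ⟨x, h⟩
          simp only [Sum.elim_inl] at this ⊢
          rw [this]
          exact .rel _ _ ⟨⟨x, h⟩, rfl, rfl⟩
        · have := inc₁_notMem f ⟨x, h⟩
          simp only [Sum.elim_inl] at this ⊢
          rw [this]
          exact .refl _
      · exact .refl _
    intro h
    have h1 := key a
    rw [h] at h1
    exact h1.trans _ _ _ ((key b).symm _ _)
  · intro h
    induction h with
    | rel s t h => obtain ⟨y, rfl, rfl⟩ := h; exact inc₁_mem f y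
    | refl => rfl
    | symm _ _ _ ih => exact ih.symm
    | trans _ _ _ _ _ ih ih' => exact ih.trans ih'

variable [DiffeologicalSpace X₁] [DiffeologicalSpace X₂]

/-- The gluing diffeology: the quotient of the disjoint union diffeology, that is, the finest
diffeology for which the maps from `X₁` and from `X₂` are smooth. -/
instance glueDiffeology : DiffeologicalSpace (Glue f) :=
  pushforwardDiffeology (inc₁ f) ⊔ pushforwardDiffeology (inc₂ f)

theorem smooth_pushforward {A B : Type*} [DiffeologicalSpace A] (d : DiffeologicalSpace B)
    (φ : A → B) (h : pushforwardDiffeology φ ≤ d) : DSmooth φ := fun n p hp ↦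
  DiffeologicalSpace.le_iff'.1 h n _
    (DiffeologicalSpace.isPlot_generatedFrom_of_mem ⟨p, hp, rfl⟩)

theorem smooth_inc₁ : DSmooth (inc₁ f) := smooth_pushforward _ _ le_sup_left

theorem smooth_inc₂ : DSmooth (inc₂ f) := smooth_pushforward _ _ le_sup_right

/-- The map `ρ̃₁^Λ` on the fibre over `z = ĩ₁(x)`. -/
def rho₁ {x : X₁} {z : Glue f} (h : inc₁ f x = z) : Lam (Glue f) z →ₗ[ℝ] Lam X₁ x :=
  lamPullback (inc₁ f) (smooth_inc₁ f) h

/-- The map `ρ̃₂^Λ` on the fibre over `z = i₂(x)`. -/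
def rho₂ {x : X₂} {z : Glue f} (h : inc₂ f x = z) : Lam (Glue f) z →ₗ[ℝ] Lam X₂ x :=
  lamPullback (inc₂ f) (smooth_inc₂ f) h

variable {f}

/-- Compatibility of `ω₁ ∈ Ω¹(X₁)` with `ω₂ ∈ Ω¹(X₂)`: `ω₁(p) = ω₂(f ∘ p)` for every plot `p`
of `Y`. -/
def CompatibleForms (hf : DSmooth f) (ω₁ : OneForm X₁) (ω₂ : OneForm X₂) : Prop :=
  OneForm.pullback (Subtype.val : Y → X₁) (smooth_val Y) ω₁ = OneForm.pullback f hf ω₂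

/-- Compatibility of elements of `Λ¹_y(X₁)` and `Λ¹_{f(y)}(X₂)`: the pair is the value of a pair
of compatible forms. -/
def CompatibleElements (hf : DSmooth f) (y : Y) (α₁ : Lam X₁ y.1) (α₂ : Lam X₂ (f y)) : Prop :=
  ∃ ω₁ ω₂, CompatibleForms hf ω₁ ω₂ ∧ valueAt y.1 ω₁ = α₁ ∧ valueAt (f y) ω₂ = α₂

/-- Compatibility of pseudo-metrics on `Λ¹(X₁)` and `Λ¹(X₂)`. -/
def CompatibleMetrics (hf : DSmooth f) (g₁ : ∀ x, LinearMap.BilinForm ℝ (Lam X₁ x))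
    (g₂ : ∀ x, LinearMap.BilinForm ℝ (Lam X₂ x)) : Prop :=
  ∀ (y : Y) (α₁ β₁ : Lam X₁ y.1) (α₂ β₂ : Lam X₂ (f y)),
    CompatibleElements hf y α₁ α₂ → CompatibleElements hf y β₁ β₂ →
    g₁ y.1 α₁ β₁ = g₂ (f y) α₂ β₂

/-- The condition `𝒟₁^Ω = 𝒟₂^Ω`: the pushforwards to `Ω¹(Y)` of the diffeologies of `Ω¹(X₁)`
(by restriction to `Y`) and of `Ω¹(X₂)` (by pullback along `f`) coincide. -/
def EqualFormDiffeologies (hf : DSmooth f) : Prop :=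
  pushforwardDiffeology (OneForm.pullback (Subtype.val : Y → X₁) (smooth_val Y)) =
    pushforwardDiffeology (OneForm.pullback f hf)

variable (f)

open Classical in
/-- The induced pseudo-metric `g^Λ` on `Λ¹(X₁ ∪_f X₂)`. -/
def gluedMetric (g₁ : ∀ x, LinearMap.BilinForm ℝ (Lam X₁ x))
    (g₂ : ∀ x, LinearMap.BilinForm ℝ (Lam X₂ x)) :
    ∀ z : Glue f, LinearMap.BilinForm ℝ (Lam (Glue f) z)
  | .left x => (g₁ x.1).compl₁₂ (rho₁ f (inc₁_notMem f x)) (rho₁ f (inc₁_notMem f x))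
  | .right x =>
    if h : ∃ y : Y, f y = x then
      have e : inc₁ f h.choose.1 = inc₂ f x := by rw [inc₁_mem, h.choose_spec]
      (1 / 2 : ℝ) • ((g₁ h.choose.1).compl₁₂ (rho₁ f e) (rho₁ f e) +
        (g₂ x).compl₁₂ (rho₂ f rfl) (rho₂ f rfl))
    else (g₂ x).compl₁₂ (rho₂ f rfl) (rho₂ f rfl)

end Gluing

/-! ### Gluing of pseudo-bundles -/

section GluingBundles

variable {X₁ : Type u₁} {X₂ : Type u₂} {Y : Set X₁} (f : Y → X₂)
  {E₁ : X₁ → Type v} [∀ x, AddCommGroup (E₁ x)] [∀ x, Module ℝ (E₁ x)]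
  {E₂ : X₂ → Type v} [∀ x, AddCommGroup (E₂ x)] [∀ x, Module ℝ (E₂ x)]
  (F : ∀ y : Y, E₁ y.1 →ₗ[ℝ] E₂ (f y))

/-- A fibrewise linear map covering `f`, as a map `χ₁⁻¹(Y) → E₂` of total spaces. -/
def coveringMap (w : (Sigma.fst ⁻¹' Y : Set (Σ x, E₁ x))) : Σ x, E₂ x :=
  ⟨f ⟨w.1.1, w.2⟩, F ⟨w.1.1, w.2⟩ w.1.2⟩

/-- The fibres of `E₁ ∪_F E₂ → X₁ ∪_f X₂`. The total space `Σ z, GlueFibre f F z` is the quotient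
of `E₁ ⊔ E₂` by the relation generated by `e ∼ F(e)`; see `totalGlue_surjective` and
`totalGlue_eq_iff`. -/
def GlueFibre (_F : ∀ y : Y, E₁ y.1 →ₗ[ℝ] E₂ (f y)) : Glue f → Type v
  | .left x => E₁ x.1
  | .right x => E₂ x

instance : ∀ z, AddCommGroup (GlueFibre f F z)
  | .left x => inferInstanceAs (AddCommGroup (E₁ x.1))
  | .right x => inferInstanceAs (AddCommGroup (E₂ x))

instance : ∀ z, Module ℝ (GlueFibre f F z)
  | .left x => inferInstanceAs (Module ℝ (E₁ x.1))
  | .right x => inferInstanceAs (Module ℝ (E₂ x))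

open Classical in
/-- The map `j̃₁ : E₁ → E₁ ∪_F E₂`. -/
def totalInc₁ (w : Σ x, E₁ x) : Σ z, GlueFibre f F z :=
  if h : w.1 ∈ Y then ⟨.right (f ⟨w.1, h⟩), F ⟨w.1, h⟩ w.2⟩ else ⟨.left ⟨w.1, h⟩, w.2⟩

/-- The map `j₂ : E₂ → E₁ ∪_F E₂`. -/
def totalInc₂ (w : Σ x, E₂ x) : Σ z, GlueFibre f F z := ⟨.right w.1, w.2⟩

theorem totalInc₁_fst (w : Σ x, E₁ x) : inc₁ f w.1 = (totalInc₁ f F w).1 := by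
  by_cases h : w.1 ∈ Y
  · simp only [inc₁, totalInc₁, h, dite_true]
  · simp only [inc₁, totalInc₁, h, dite_false]

theorem totalInc₁_mem (w : (Sigma.fst ⁻¹' Y : Set (Σ x, E₁ x))) :
    totalInc₁ f F w = totalInc₂ f F (coveringMap f F w) := by
  have h : w.1.1 ∈ Y := w.2
  simp only [totalInc₁, totalInc₂, coveringMap, h, dite_true]

theorem totalInc₁_notMem (w : Σ x, E₁ x) (h : w.1 ∉ Y) :
    totalInc₁ f F w = ⟨.left ⟨w.1, h⟩, w.2⟩ := by
  simp only [totalInc₁, h, dite_false]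

theorem totalGlue_surjective :
    Function.Surjective (Sum.elim (totalInc₁ f F) (totalInc₂ f F)) := by
  rintro ⟨x | x, e⟩
  · exact ⟨Sum.inl ⟨x.1, e⟩, totalInc₁_notMem f F ⟨x.1, e⟩ x.2⟩
  · exact ⟨Sum.inr ⟨x, e⟩, rfl⟩

theorem totalGlue_eq_iff (a b : (Σ x, E₁ x) ⊕ (Σ x, E₂ x)) :
    Sum.elim (totalInc₁ f F) (totalInc₂ f F) a = Sum.elim (totalInc₁ f F) (totalInc₂ f F) b ↔
      Relation.EqvGen (fun s t ↦ ∃ w : (Sigma.fst ⁻¹' Y : Set (Σ x, E₁ x)),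
        s = Sum.inl w.1 ∧ t = Sum.inr (coveringMap f F w)) a b := by
  constructor
  · let back : (Σ z, GlueFibre f F z) → (Σ x, E₁ x) ⊕ (Σ x, E₂ x)
      | ⟨.left x, e⟩ => Sum.inl ⟨x.1, e⟩
      | ⟨.right x, e⟩ => Sum.inr ⟨x, e⟩
    have key : ∀ s, Relation.EqvGen (fun s t ↦ ∃ w : (Sigma.fst ⁻¹' Y : Set (Σ x, E₁ x)),
        s = Sum.inl w.1 ∧ t = Sum.inr (coveringMap f F w)) s
        (back (Sum.elim (totalInc₁ f F) (totalInc₂ f F) s)) := by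
      rintro (w | w)
      · by_cases h : w.1 ∈ Y
        · have := totalInc₁_mem f F ⟨w, h⟩
          simp only [Sum.elim_inl] at this ⊢
          rw [this]
          exact .rel _ _ ⟨⟨w, h⟩, rfl, rfl⟩
        · simp only [Sum.elim_inl]
          rw [totalInc₁_notMem f F w h]
          exact .refl _
      · exact .refl _
    intro h
    have h1 := key a
    rw [h] at h1
    exact h1.trans _ _ _ ((key b).symm _ _)
  · intro h
    induction h with
    | rel s t h => obtain ⟨w, rfl, rfl⟩ := h; exact totalInc₁_mem f F w
    | refl => rfl
    | symm _ _ _ ih => exact ih.symm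
    | trans _ _ _ _ _ ih ih' => exact ih.trans ih'

/-- The gluing diffeology on the total space of `E₁ ∪_F E₂`. -/
instance totalGlueDiffeology [DiffeologicalSpace (Σ x, E₁ x)] [DiffeologicalSpace (Σ x, E₂ x)] :
    DiffeologicalSpace (Σ z, GlueFibre f F z) :=
  pushforwardDiffeology (totalInc₁ f F) ⊔ pushforwardDiffeology (totalInc₂ f F)

variable [DiffeologicalSpace X₁] [DiffeologicalSpace X₂]
  {g₁ : ∀ x, LinearMap.BilinForm ℝ (Lam X₁ x)} {g₂ : ∀ x, LinearMap.BilinForm ℝ (Lam X₂ x)}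
  (c₁ : ∀ x, Cl g₁ x →ₐ[ℝ] Module.End ℝ (E₁ x)) (c₂ : ∀ x, Cl g₂ x →ₐ[ℝ] Module.End ℝ (E₂ x))

/-- Compatibility of the Clifford actions with the gluing along `(F, f)`:
`c₂(ρ̃₂ α)(F e) = F(c₁(ρ̃₁ α) e)` for all `y ∈ Y`, `α ∈ Λ¹_{i₂(f(y))}(X₁ ∪_f X₂)` and `e` in the
fibre of `E₁` over `y`. -/
def CompatibleActions : Prop :=
  ∀ (y : Y) (α : Lam (Glue f) (inc₂ f (f y))) (e : E₁ y.1),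
    c₂ (f y) (toCl g₂ (f y) (rho₂ f rfl α)) (F y e) =
      F y (c₁ y.1 (toCl g₁ y.1 (rho₁ f (inc₁_mem f y) α)) e)

/-- The induced action `c̃` of `Λ¹(X₁ ∪_f X₂)` on `E₁ ∪_F E₂`. -/
def inducedAction : ∀ z : Glue f, Lam (Glue f) z → Module.End ℝ (GlueFibre f F z)
  | .left x => fun α ↦ c₁ x.1 (toCl g₁ x.1 (rho₁ f (inc₁_notMem f x) α))
  | .right x => fun α ↦ c₂ x (toCl g₂ x (rho₂ f rfl α))

end GluingBundles

end DiffGluing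

end

open DiffGluing

/-!
Everything is local, and plots of `X₁ ∪_f X₂` and of `E₁ ∪_F E₂` lift locally to one of the two
pieces (`exists_local_lift`). Restriction of a plot to a neighbourhood of a point is expressed by
composition with a smooth self-map of `ℝⁿ` which is the identity near that point
(`IsLocalIdentity`).

*The pseudo-metric.* Evaluating forms on plots through `x` gives smooth functionals on `Λ¹_x` which
separate its points. Hence for finite-dimensional fibres every functional is smooth
(`smoothDual_lam_eq_top`), and the rank condition on a pseudo-metric on `Λ¹` says exactly that it is
positive definite (`IsPseudoMetric.eq_zero_of_lam`). An element of `Λ¹_z(X₁ ∪_f X₂)` is determined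
by its pullbacks to `X₁` and `X₂` (`lam_glue_eq_zero`), so these fibres are finite-dimensional too.
Two such pullbacks over a point of `Y` are compatible, so compatibility of `g₁` and `g₂` makes the
glued form the pullback of `g₁` over all of `X₁` and of `g₂` over all of `X₂`
(`gluedMetric_inc₁`, `gluedMetric_inc₂`). Smoothness, positivity and definiteness are then
inherited from the pieces.

*The Clifford action.* Since the glued form is a pullback, the induced action satisfies the Clifford
relation and extends uniquely by the universal property of the Clifford algebra. Compatibility of
the actions says that the inclusions of `E₁` and `E₂` intertwine the extension with the given
actions, through the homomorphisms of Clifford algebras induced by pullback of covectors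
(`clifford_intertwine`). These homomorphisms take plots to plots (`isPlot_clPullback`), so smoothness
of the action on a plot of the glued bundle follows from smoothness of `c₁` or `c₂` on a local lift.
For the addition, two plots over the same base have to be lifted to the same piece, which is possible
as a plot of `E₁` over `Y` can be moved to `E₂` by `F` (`exists_local_common_lift`).
-/

namespace DiffGluing

/-! ### Localisation of plots -/

/-- `r` is a smooth self-map of `ℝⁿ` which agrees with the identity near `x`. Plots being defined on
all of `ℝⁿ`, restricting a plot `p` to a neighbourhood of `x` is expressed by passing to `p ∘ r`. -/
def IsLocalIdentity {n : ℕ} (x : Euc n) (r : Euc n → Euc n) : Prop :=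
  ContDiff ℝ ∞ r ∧ ∀ᶠ z in 𝓝 x, r z = z

theorem IsLocalIdentity.apply_self {n : ℕ} {x : Euc n} {r : Euc n → Euc n}
    (hr : IsLocalIdentity x r) : r x = x :=
  hr.2.self_of_nhds

theorem IsLocalIdentity.comp {n : ℕ} {x : Euc n} {r r' : Euc n → Euc n}
    (hr : IsLocalIdentity x r) (hr' : IsLocalIdentity x r') : IsLocalIdentity x (r ∘ r') := by
  refine ⟨hr.1.comp hr'.1, ?_⟩
  filter_upwards [hr.2, hr'.2] with z hz hz'
  simp [hz, hz']

theorem IsLocalIdentity.hasFDerivAt {n : ℕ} {x : Euc n} {r : Euc n → Euc n}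
    (hr : IsLocalIdentity x r) : HasFDerivAt r (ContinuousLinearMap.id ℝ (Euc n)) x :=
  (hasFDerivAt_id x).congr_of_eventuallyEq hr.2

section Local

variable {A B : Type*}

theorem isPlot_of_local [DiffeologicalSpace A] {n : ℕ} {p : Euc n → A}
    (h : ∀ x, ∃ r, IsLocalIdentity x r ∧ IsPlot (p ∘ r)) : IsPlot p :=
  DiffeologicalSpace.locality fun x ↦ by
    obtain ⟨r, ⟨-, hrx⟩, hp⟩ := h x
    obtain ⟨u, hu, huo, hxu⟩ := eventually_nhds_iff.1 hrx
    refine ⟨u, huo, hxu, fun {m f} hfu hf ↦ ?_⟩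
    have : p ∘ f = (p ∘ r) ∘ f := funext fun t ↦ by simp [hu _ (hfu t)]
    rw [this]
    exact isPlot_reparam hp hf

/-- The maps that locally belong to a family of maps which contains the constant maps and is stable
under smooth reparametrisation form a diffeology. -/
@[reducible] def localDiffeology (g : Set (Σ n, Euc n → A))
    (hconst : ∀ n a, (⟨n, fun _ ↦ a⟩ : Σ n, Euc n → A) ∈ g)
    (hrep : ∀ m n (p : Euc n → A) (φ : Euc m → Euc n), ContDiff ℝ ∞ φ →
      (⟨n, p⟩ : Σ n, Euc n → A) ∈ g → (⟨m, p ∘ φ⟩ : Σ n, Euc n → A) ∈ g) :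
    DiffeologicalSpace A where
  plots n := {p | ∀ x, ∃ r, IsLocalIdentity x r ∧ (⟨n, p ∘ r⟩ : Σ n, Euc n → A) ∈ g}
  constant_plots a := fun x ↦ ⟨id, ⟨contDiff_id, by simp⟩, hconst _ a⟩
  plot_reparam {n m p φ} hp hφ := fun x ↦ by
    obtain ⟨r, ⟨-, hrx⟩, hg⟩ := hp (φ x)
    obtain ⟨u, hu, huo, hxu⟩ := eventually_nhds_iff.1 hrx
    obtain ⟨r', hr', hru, hrx'⟩ := exists_retraction (huo.preimage hφ.continuous) hxu
    refine ⟨r', ⟨hr', hrx'⟩, ?_⟩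
    have : (p ∘ φ) ∘ r' = (p ∘ r) ∘ (φ ∘ r') := funext fun t ↦ by simp [hu _ (hru t)]
    rw [this]
    exact hrep _ _ _ _ (hφ.comp hr') hg
  locality {n p} hp := fun x ↦ by
    obtain ⟨u, hu, hxu, h⟩ := hp x
    obtain ⟨r, hr, hru, hrx⟩ := exists_retraction hu hxu
    have hloc : IsLocalIdentity x r := ⟨hr, hrx⟩
    obtain ⟨r', hr', hg⟩ := h hru hr x
    exact ⟨r ∘ r', hloc.comp hr', hg⟩

theorem exists_local_of_isPlot_generateFrom {g : Set (Σ n, Euc n → A)}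
    (hconst : ∀ n a, (⟨n, fun _ ↦ a⟩ : Σ n, Euc n → A) ∈ g)
    (hrep : ∀ m n (p : Euc n → A) (φ : Euc m → Euc n), ContDiff ℝ ∞ φ →
      (⟨n, p⟩ : Σ n, Euc n → A) ∈ g → (⟨m, p ∘ φ⟩ : Σ n, Euc n → A) ∈ g)
    {n : ℕ} {p : Euc n → A} (hp : @IsPlot _ (DiffeologicalSpace.generateFrom g) n p) (x : Euc n) :
    ∃ r, IsLocalIdentity x r ∧ (⟨n, p ∘ r⟩ : Σ n, Euc n → A) ∈ g := by
  have hle : DiffeologicalSpace.generateFrom g ≤ localDiffeology g hconst hrep :=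
    DiffeologicalSpace.generateFrom_le_iff.2 fun m q hq y ↦
      ⟨id, ⟨contDiff_id, by simp⟩, hq⟩
  exact DiffeologicalSpace.le_iff'.1 hle _ _ hp x

/-- Smoothness on a generated diffeology can be tested on the generating plots. -/
theorem dSmooth_generateFrom [DiffeologicalSpace B] {g : Set (Σ n, Euc n → A)} {φ : A → B}
    (h : ∀ n (p : Euc n → A), (⟨n, p⟩ : Σ n, Euc n → A) ∈ g → IsPlot (φ ∘ p)) :
    @DSmooth _ _ (DiffeologicalSpace.generateFrom g) _ φ := by
  have hle : DiffeologicalSpace.generateFrom g ≤ pullbackDiffeology φ :=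
    DiffeologicalSpace.generateFrom_le_iff.2 h
  exact fun n p hp ↦ DiffeologicalSpace.le_iff'.1 hle n p hp

/-- A plot for the finest diffeology making two jointly surjective maps smooth lifts locally along
one of them. -/
theorem exists_local_lift {A₁ A₂ : Type*} [DiffeologicalSpace A₁] [DiffeologicalSpace A₂]
    {j₁ : A₁ → B} {j₂ : A₂ → B} (hj : Function.Surjective (Sum.elim j₁ j₂)) {n : ℕ}
    {p : Euc n → B}
    (hp : @IsPlot _ (pushforwardDiffeology j₁ ⊔ pushforwardDiffeology j₂) n p) (x : Euc n) :
    ∃ r, IsLocalIdentity x r ∧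
      ((∃ q : Euc n → A₁, IsPlot q ∧ p ∘ r = j₁ ∘ q) ∨
        ∃ q : Euc n → A₂, IsPlot q ∧ p ∘ r = j₂ ∘ q) := by
  rw [pushforwardDiffeology, pushforwardDiffeology,
    ← DiffeologicalSpace.generateFrom_union] at hp
  refine exists_local_of_isPlot_generateFrom ?_ ?_ hp x
  · intro m b
    obtain ⟨a | a, rfl⟩ := hj b
    · exact Or.inl ⟨fun _ ↦ a, isPlot_const, rfl⟩
    · exact Or.inr ⟨fun _ ↦ a, isPlot_const, rfl⟩
  · rintro m n p φ hφ (⟨q, hq, h⟩ | ⟨q, hq, h⟩)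
    · exact Or.inl ⟨q ∘ φ, isPlot_reparam hq hφ, congrArg (· ∘ φ) h⟩
    · exact Or.inr ⟨q ∘ φ, isPlot_reparam hq hφ, congrArg (· ∘ φ) h⟩

end Local

/-! ### The fibres of `Λ¹` and their smooth duals -/

section Forms

variable {X Z : Type*} [DiffeologicalSpace X] [DiffeologicalSpace Z]

theorem valueAt_surjective (x : X) : Function.Surjective (valueAt (X := X) x) :=
  Submodule.mkQ_surjective _

theorem valueAt_eq_zero_iff {x : X} {θ : OneForm X} :
    valueAt x θ = 0 ↔ θ ∈ vanishingAt X x :=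
  Submodule.Quotient.mk_eq_zero _

/-- A 1-form takes the same value on a plot and on its localisation. -/
theorem oneForm_apply_comp_localIdentity (θ : OneForm X) {n : ℕ}
    (p : {p : Euc n → X // IsPlot p}) {r : Euc n → Euc n} {x : Euc n} (hr : IsLocalIdentity x r) :
    θ.1 n ⟨p.1 ∘ r, isPlot_reparam p.2 hr.1⟩ x = θ.1 n p x := by
  rw [θ.2.2 n n p r hr.1 x, hr.hasFDerivAt.fderiv, hr.apply_self, ContinuousLinearMap.comp_id]

/-- A plot of `Λ¹(X)` is locally `t ↦ η(t)_{b(t)}` for plots `b` of `X` and `η` of `Ω¹(X)`. -/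
theorem exists_local_section {n : ℕ} {w : Euc n → Σ x, Lam X x} (hw : IsPlot w) (x : Euc n) :
    ∃ r, IsLocalIdentity x r ∧ ∃ (b : Euc n → X) (η : Euc n → OneForm X), IsPlot b ∧ IsPlot η ∧
      w ∘ r = fun t ↦ ⟨b t, valueAt (b t) (η t)⟩ := by
  refine exists_local_of_isPlot_generateFrom ?_ ?_ hw x
  · rintro m ⟨x, α⟩
    obtain ⟨θ, rfl⟩ := valueAt_surjective x α
    exact ⟨fun _ ↦ x, fun _ ↦ θ, isPlot_const, isPlot_const, rfl⟩
  · rintro m n p φ hφ ⟨b, η, hb, hη, h⟩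
    exact ⟨b ∘ φ, η ∘ φ, isPlot_reparam hb hφ, isPlot_reparam hη hφ, congrArg (· ∘ φ) h⟩

theorem isPlot_fst_lam {n : ℕ} {w : Euc n → Σ x, Lam X x} (hw : IsPlot w) :
    IsPlot (fun t ↦ (w t).1) :=
  isPlot_of_local fun x ↦ by
    obtain ⟨r, hr, b, η, hb, -, h⟩ := exists_local_section hw x
    refine ⟨r, hr, ?_⟩
    have : (fun t ↦ (w t).1) ∘ r = b := funext fun t ↦ congrArg Sigma.fst (congrFun h t)
    rwa [this]

/-- The pullback of forms along `ι` is smooth on plots of `Λ¹` lying over plots `ι ∘ x`. -/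
theorem isPlot_lamPullback {ι : X → Z} (hι : DSmooth ι) {n : ℕ} {x : Euc n → X} (hx : IsPlot x)
    {w : ∀ t, Lam Z (ι (x t))} (hw : IsPlot (fun t ↦ (⟨ι (x t), w t⟩ : Σ z, Lam Z z))) :
    IsPlot (fun t ↦ (⟨x t, lamPullback ι hι rfl (w t)⟩ : Σ x, Lam X x)) :=
  isPlot_of_local fun s ↦ by
    obtain ⟨r, hr, b, η, -, hη, h⟩ := exists_local_section hw s
    refine ⟨r, hr, DiffeologicalSpace.isPlot_generatedFrom_of_mem
      ⟨x ∘ r, fun t ↦ OneForm.pullback ι hι (η t), isPlot_reparam hx hr.1,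
        fun m p ↦ hη m ⟨ι ∘ p.1, hι m p.1 p.2⟩, ?_⟩⟩
    obtain rfl : (fun t ↦ ι (x (r t))) = b := funext fun t ↦ congrArg Sigma.fst (congrFun h t)
    funext t
    have ht : w (r t) = valueAt _ (η t) := eq_of_heq (Sigma.mk.inj (congrFun h t)).2
    simp only [Function.comp_apply, ht]
    rfl

/-- The functional `θ_x ↦ θ(p)(0)(v)` on `Λ¹_x(X)`, for a plot `p` with `p(0) = x`. -/
def evalAt {x : X} {n : ℕ} (p : {p : Euc n → X // IsPlot p}) (hp : p.1 0 = x) (v : Euc n) :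
    Lam X x →ₗ[ℝ] ℝ :=
  (vanishingAt X x).liftQ
    { toFun := fun θ ↦ θ.1 n p 0 v
      map_add' := fun _ _ ↦ rfl
      map_smul' := fun _ _ ↦ rfl }
    (fun _ hθ ↦ DFunLike.congr_fun (hθ n p hp) v)

theorem evalAt_mem_smoothDual {x : X} {n : ℕ} (p : {p : Euc n → X // IsPlot p}) (hp : p.1 0 = x)
    (v : Euc n) : evalAt p hp v ∈ smoothDual (Lam X) x := by
  intro m w hw
  refine isPlot_of_local fun s ↦ ?_
  obtain ⟨r, hr, b, η, -, hη, h⟩ := exists_local_section hw s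
  refine ⟨r, hr, ?_⟩
  obtain rfl : (fun _ ↦ x) = b := funext fun t ↦ congrArg Sigma.fst (congrFun h t)
  have ht : (evalAt p hp v ∘ w) ∘ r = fun t ↦ (η t).1 n p 0 v := by
    funext t
    have ht : w (r t) = valueAt x (η t) := eq_of_heq (Sigma.mk.inj (congrFun h t)).2
    simp only [Function.comp_apply, ht]
    rfl
  rw [ht]
  exact (((hη n p).comp (contDiff_id.prodMk contDiff_const)).clm_apply contDiff_const).isPlot

/-- The evaluations on plots are smooth functionals that separate the points of `Λ¹_x(X)`, so in
finite dimension every functional is smooth. -/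
theorem smoothDual_lam_eq_top (x : X) [FiniteDimensional ℝ (Lam X x)] :
    smoothDual (Lam X) x = ⊤ := by
  have h : (smoothDual (Lam X) x).dualCoannihilator = ⊥ := by
    rw [eq_bot_iff]
    intro α hα
    rw [Submodule.mem_dualCoannihilator] at hα
    obtain ⟨θ, rfl⟩ := valueAt_surjective x α
    refine valueAt_eq_zero_iff.2 fun n p hp ↦ ?_
    ext v
    exact hα _ (evalAt_mem_smoothDual p hp v)
  rw [← Subspace.dualCoannihilator_dualAnnihilator_eq (W := smoothDual (Lam X) x), h,
    Submodule.dualAnnihilator_bot]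

theorem finrank_smoothDual_lam (x : X) [FiniteDimensional ℝ (Lam X x)] :
    Module.finrank ℝ (smoothDual (Lam X) x) = Module.finrank ℝ (Lam X x) := by
  rw [smoothDual_lam_eq_top, finrank_top, Subspace.dual_finrank_eq]

/-- On `Λ¹` the rank condition forces a pseudo-metric to be positive definite. -/
theorem IsPseudoMetric.eq_zero_of_lam {g : ∀ x, LinearMap.BilinForm ℝ (Lam X x)}
    (hg : IsPseudoMetric g) {x : X} [FiniteDimensional ℝ (Lam X x)] {α : Lam X x}
    (hα : g x α α = 0) : α = 0 := by
  have hker : LinearMap.ker (g x) = ⊥ := by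
    have := hg.rank x
    rw [finrank_smoothDual_lam] at this
    exact Submodule.finrank_eq_zero.1 (by omega)
  have : α ∈ LinearMap.ker (g x) :=
    (LinearMap.BilinForm.apply_apply_same_eq_zero_iff (g x) (hg.nonneg x)
      ⟨fun v w ↦ hg.symm x v w⟩).1 hα
  simpa [hker] using this

end Forms

/-! ### Lifting along the universal property of the Clifford algebra -/

section Clifford

variable {X : Type*} {V : X → Type*} [∀ x, AddCommGroup (V x)] [∀ x, Module ℝ (V x)]
  (g : ∀ x, LinearMap.BilinForm ℝ (V x))

theorem toCl_mul_self (x : X) (w : V x) :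
    toCl g x w * toCl g x w = algebraMap ℝ (Cl g x) (-(g x w w)) :=
  CliffordAlgebra.ι_sq_scalar _ w

variable {g} {A : Type*} [Ring A] [Algebra ℝ A]

/-- The extension to `Cl(V_x, g(x))` of a linear map with `φ(w)² = -g(w, w)`. -/
def clLift {x : X} (φ : V x →ₗ[ℝ] A) (h : ∀ w, φ w * φ w = algebraMap ℝ A (-(g x w w))) :
    Cl g x →ₐ[ℝ] A :=
  CliffordAlgebra.lift (-(LinearMap.BilinMap.toQuadraticMap (g x))) ⟨φ, h⟩

theorem clLift_toCl {x : X} (φ : V x →ₗ[ℝ] A)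
    (h : ∀ w, φ w * φ w = algebraMap ℝ A (-(g x w w))) (w : V x) :
    clLift φ h (toCl g x w) = φ w :=
  CliffordAlgebra.lift_ι_apply (Q := -(LinearMap.BilinMap.toQuadraticMap (g x))) φ h w

theorem cl_algHom_ext {x : X} {φ ψ : Cl g x →ₐ[ℝ] A}
    (h : ∀ w, φ (toCl g x w) = ψ (toCl g x w)) : φ = ψ :=
  CliffordAlgebra.hom_ext (LinearMap.ext h)

theorem cl_induction {x : X} {P : Cl g x → Prop} (algebraMap : ∀ a, P (algebraMap ℝ (Cl g x) a))
    (toCl : ∀ w, P (toCl g x w)) (mul : ∀ a b, P a → P b → P (a * b))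
    (add : ∀ a b, P a → P b → P (a + b)) (a : Cl g x) : P a :=
  CliffordAlgebra.induction (Q := -(LinearMap.BilinMap.toQuadraticMap (g x)))
    algebraMap toCl mul add a

end Clifford

/-! ### The glued pseudo-metric -/

section Metric

variable {X₁ : Type u₁} {X₂ : Type u₂} {Y : Set X₁} (f : Y → X₂)

theorem IsDiffeoOntoImage.injective {A B : Type*} [DiffeologicalSpace A] [DiffeologicalSpace B]
    {f : A → B} (hf : IsDiffeoOntoImage f) : Function.Injective f := by
  obtain ⟨e, he, -⟩ := hf
  intro a b h
  exact e.injective (Subtype.ext (by rw [he, he, h]))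

theorem inc₂_injective : Function.Injective (inc₂ f) := fun _ _ h ↦ Glue.right.inj h

theorem inc₁_eq_inc₂_iff {x : X₁} {x' : X₂} :
    inc₁ f x = inc₂ f x' ↔ ∃ h : x ∈ Y, f ⟨x, h⟩ = x' := by
  by_cases h : x ∈ Y
  · simp [inc₁, inc₂, h]
  · simp [inc₁, inc₂, h]

theorem exists_inc (z : Glue f) : (∃ x, inc₁ f x = z) ∨ ∃ x, inc₂ f x = z := by
  obtain ⟨x | x, rfl⟩ := glue_surjective f z
  · exact Or.inl ⟨x, rfl⟩
  · exact Or.inr ⟨x, rfl⟩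

variable {f}

theorem inc₁_injective (hf : Function.Injective f) : Function.Injective (inc₁ f) := by
  intro x x' h
  by_cases hx : x ∈ Y
  · rw [show inc₁ f x = inc₂ f (f ⟨x, hx⟩) from inc₁_mem f ⟨x, hx⟩, eq_comm,
      inc₁_eq_inc₂_iff] at h
    obtain ⟨hx', h⟩ := h
    exact (congrArg Subtype.val (hf h)).symm
  · by_cases hx' : x' ∈ Y
    · rw [show inc₁ f x' = inc₂ f (f ⟨x', hx'⟩) from inc₁_mem f ⟨x', hx'⟩,
        inc₁_eq_inc₂_iff] at h
      exact absurd h.1 hx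
    · simpa [inc₁, hx, hx'] using h

variable [DiffeologicalSpace X₁] [DiffeologicalSpace X₂]

/-- An element of `Λ¹_z(X₁ ∪_f X₂)` is determined by its pullbacks to `X₁` and `X₂`, since every plot
through `z` lifts near the origin to `X₁` or to `X₂`. -/
theorem lam_glue_eq_zero {z : Glue f} {α : Lam (Glue f) z}
    (h₁ : ∀ x (h : inc₁ f x = z), rho₁ f h α = 0) (h₂ : ∀ x (h : inc₂ f x = z), rho₂ f h α = 0) :
    α = 0 := by
  obtain ⟨θ, rfl⟩ := valueAt_surjective z α
  refine valueAt_eq_zero_iff.2 fun n p hp ↦ ?_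
  obtain ⟨r, hr, ⟨q, hq, h⟩ | ⟨q, hq, h⟩⟩ :=
    exists_local_lift (glue_surjective f) p.2 0
  · have hz : inc₁ f (q 0) = z := by
      rw [← hp]
      exact (congrFun h 0).symm.trans (congrArg p.1 hr.apply_self)
    have := valueAt_eq_zero_iff.1 (h₁ _ hz) n ⟨q, hq⟩ rfl
    rw [← oneForm_apply_comp_localIdentity θ p hr]
    simp only [h]
    exact this
  · have hz : inc₂ f (q 0) = z := by
      rw [← hp]
      exact (congrFun h 0).symm.trans (congrArg p.1 hr.apply_self)
    have := valueAt_eq_zero_iff.1 (h₂ _ hz) n ⟨q, hq⟩ rfl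
    rw [← oneForm_apply_comp_localIdentity θ p hr]
    simp only [h]
    exact this

theorem finiteDimensional_lam_glue (hf : Function.Injective f)
    (hfin₁ : ∀ x, FiniteDimensional ℝ (Lam X₁ x)) (hfin₂ : ∀ x, FiniteDimensional ℝ (Lam X₂ x))
    (z : Glue f) : FiniteDimensional ℝ (Lam (Glue f) z) := by
  -- At most one point of each `Xᵢ` lies over `z`, so both products below are finite.
  have : Subsingleton {x // inc₁ f x = z} :=
    ⟨fun a b ↦ Subtype.ext (inc₁_injective hf (a.2.trans b.2.symm))⟩
  have : Subsingleton {x // inc₂ f x = z} :=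
    ⟨fun a b ↦ Subtype.ext (inc₂_injective f (a.2.trans b.2.symm))⟩
  let Φ : Lam (Glue f) z →ₗ[ℝ]
      (∀ x : {x // inc₁ f x = z}, Lam X₁ x.1) × (∀ x : {x // inc₂ f x = z}, Lam X₂ x.1) :=
    (LinearMap.pi fun x ↦ rho₁ f x.2).prod (LinearMap.pi fun x ↦ rho₂ f x.2)
  refine FiniteDimensional.of_injective Φ ((injective_iff_map_eq_zero Φ).2 fun α hα ↦ ?_)
  exact lam_glue_eq_zero (fun x h ↦ congrFun (congrArg Prod.fst hα) ⟨x, h⟩)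
    (fun x h ↦ congrFun (congrArg Prod.snd hα) ⟨x, h⟩)

/-- The two pullbacks of an element of `Λ¹(X₁ ∪_f X₂)` over `Y` are compatible. -/
theorem compatibleElements_rho (hf : DSmooth f) {y : Y} {z : Glue f} (h₁ : inc₁ f y = z)
    (h₂ : inc₂ f (f y) = z) (α : Lam (Glue f) z) :
    CompatibleElements hf y (rho₁ f h₁ α) (rho₂ f h₂ α) := by
  obtain ⟨θ, rfl⟩ := valueAt_surjective z α
  refine ⟨OneForm.pullback _ (smooth_inc₁ f) θ, OneForm.pullback _ (smooth_inc₂ f) θ,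
    Subtype.ext (funext fun n ↦ funext fun p ↦ ?_), rfl, rfl⟩
  exact congrArg (θ.1 n) (Subtype.ext (funext fun t ↦ inc₁_mem f (p.1 t)))

variable {g₁ : ∀ x, LinearMap.BilinForm ℝ (Lam X₁ x)} {g₂ : ∀ x, LinearMap.BilinForm ℝ (Lam X₂ x)}

/-- By compatibility the two terms of the average over `Y` agree. -/
theorem gluedMetric_inc₂ (hf : DSmooth f) (hg : CompatibleMetrics hf g₁ g₂) {x : X₂} {z : Glue f}
    (h : inc₂ f x = z) (α β : Lam (Glue f) z) :
    gluedMetric f g₁ g₂ z α β = g₂ x (rho₂ f h α) (rho₂ f h β) := by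
  subst h
  by_cases hx : ∃ y : Y, f y = x
  · have e : inc₁ f hx.choose.1 = inc₂ f x := by rw [inc₁_mem, hx.choose_spec]
    have key : ∀ (y : Y) (_ : f y = x) (e : inc₁ f y.1 = inc₂ f x),
        g₁ y.1 (rho₁ f e α) (rho₁ f e β) = g₂ x (rho₂ f rfl α) (rho₂ f rfl β) := by
      rintro y rfl e
      exact hg y _ _ _ _ (compatibleElements_rho hf e rfl α) (compatibleElements_rho hf e rfl β)
    have hdef : gluedMetric f g₁ g₂ (inc₂ f x) =
        (1 / 2 : ℝ) • ((g₁ hx.choose.1).compl₁₂ (rho₁ f e) (rho₁ f e) +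
          (g₂ x).compl₁₂ (rho₂ f rfl) (rho₂ f rfl)) := dif_pos hx
    rw [hdef]
    change (1 / 2 : ℝ) * (g₁ hx.choose.1 (rho₁ f e α) (rho₁ f e β) +
      g₂ x (rho₂ f rfl α) (rho₂ f rfl β)) = _
    rw [key _ hx.choose_spec e]
    ring
  · have hdef : gluedMetric f g₁ g₂ (inc₂ f x) = (g₂ x).compl₁₂ (rho₂ f rfl) (rho₂ f rfl) :=
      dif_neg hx
    rw [hdef]
    rfl

theorem gluedMetric_inc₁ (hf : DSmooth f) (hg : CompatibleMetrics hf g₁ g₂) {x : X₁} {z : Glue f}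
    (h : inc₁ f x = z) (α β : Lam (Glue f) z) :
    gluedMetric f g₁ g₂ z α β = g₁ x (rho₁ f h α) (rho₁ f h β) := by
  by_cases hx : x ∈ Y
  · have h₂ : inc₂ f (f ⟨x, hx⟩) = z := by rw [← inc₁_mem, h]
    rw [gluedMetric_inc₂ hf hg h₂]
    exact (hg ⟨x, hx⟩ _ _ _ _ (compatibleElements_rho hf h h₂ α)
      (compatibleElements_rho hf h h₂ β)).symm
  · obtain rfl : z = .left ⟨x, hx⟩ := h.symm.trans (inc₁_notMem f ⟨x, hx⟩)
    rfl

theorem isPlot_bilinForm_of_lift {X Z : Type*} [DiffeologicalSpace X] [DiffeologicalSpace Z]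
    {ι : X → Z} (hι : DSmooth ι) {g : ∀ x, LinearMap.BilinForm ℝ (Lam X x)}
    (hg : IsPseudoMetric g) {G : ∀ z, LinearMap.BilinForm ℝ (Lam Z z)}
    (hG : ∀ x α β, G (ι x) α β = g x (lamPullback ι hι rfl α) (lamPullback ι hι rfl β))
    {n : ℕ} {b : Euc n → Z} {x : Euc n → X} (hx : IsPlot x) (hb : b = ι ∘ x)
    {w w' : ∀ t, Lam Z (b t)} (hw : IsPlot (fun t ↦ (⟨b t, w t⟩ : Σ z, Lam Z z)))
    (hw' : IsPlot (fun t ↦ (⟨b t, w' t⟩ : Σ z, Lam Z z))) :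
    IsPlot (fun t ↦ G (b t) (w t) (w' t)) := by
  subst hb
  simp only [Function.comp_apply, hG]
  exact hg.smooth n x _ _ (isPlot_lamPullback hι hx hw) (isPlot_lamPullback hι hx hw')

theorem isPseudoMetric_gluedMetric (hfin₁ : ∀ x, FiniteDimensional ℝ (Lam X₁ x))
    (hfin₂ : ∀ x, FiniteDimensional ℝ (Lam X₂ x)) (hf : DSmooth f) (hinj : Function.Injective f)
    (hg₁ : IsPseudoMetric g₁) (hg₂ : IsPseudoMetric g₂) (hg : CompatibleMetrics hf g₁ g₂) :
    IsPseudoMetric (gluedMetric f g₁ g₂) where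
  smooth n b w w' hw hw' := isPlot_of_local fun s ↦ by
    obtain ⟨r, hr, ⟨x, hx, h⟩ | ⟨x, hx, h⟩⟩ :=
      exists_local_lift (glue_surjective f) (isPlot_fst_lam hw) s
    · exact ⟨r, hr, isPlot_bilinForm_of_lift (smooth_inc₁ f) hg₁
        (fun x α β ↦ gluedMetric_inc₁ hf hg rfl α β) hx h
        (isPlot_reparam hw hr.1) (isPlot_reparam hw' hr.1)⟩
    · exact ⟨r, hr, isPlot_bilinForm_of_lift (smooth_inc₂ f) hg₂
        (fun x α β ↦ gluedMetric_inc₂ hf hg rfl α β) hx h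
        (isPlot_reparam hw hr.1) (isPlot_reparam hw' hr.1)⟩
  symm z α β := by
    obtain ⟨x, rfl⟩ | ⟨x, rfl⟩ := exists_inc f z
    · rw [gluedMetric_inc₁ hf hg rfl, gluedMetric_inc₁ hf hg rfl, hg₁.symm]
    · rw [gluedMetric_inc₂ hf hg rfl, gluedMetric_inc₂ hf hg rfl, hg₂.symm]
  nonneg z α := by
    obtain ⟨x, rfl⟩ | ⟨x, rfl⟩ := exists_inc f z
    · rw [gluedMetric_inc₁ hf hg rfl]
      exact hg₁.nonneg _ _
    · rw [gluedMetric_inc₂ hf hg rfl]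
      exact hg₂.nonneg _ _
  rank z := by
    have := finiteDimensional_lam_glue hinj hfin₁ hfin₂ z
    have hker : LinearMap.ker (gluedMetric f g₁ g₂ z) = ⊥ := by
      refine (Submodule.eq_bot_iff _).2 fun α hα ↦ ?_
      have hα : gluedMetric f g₁ g₂ z α α = 0 := by rw [LinearMap.mem_ker.1 hα]; rfl
      exact lam_glue_eq_zero
        (fun x h ↦ hg₁.eq_zero_of_lam (by rwa [← gluedMetric_inc₁ hf hg h]))
        (fun x h ↦ hg₂.eq_zero_of_lam (by rwa [← gluedMetric_inc₂ hf hg h]))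
    rw [hker, finrank_bot, finrank_smoothDual_lam, zero_add]

end Metric

/-! ### Fibrewise linear maps of pseudo-bundles -/

section Along

variable {X Z : Type*} {E : X → Type*} [∀ x, AddCommGroup (E x)] [∀ x, Module ℝ (E x)]
  {G : Z → Type*} [∀ z, AddCommGroup (G z)] [∀ z, Module ℝ (G z)]

/-- The map of total spaces given by linear maps between the fibres, covering `ι`. -/
def totalMap (ι : X → Z) (L : ∀ x, E x →ₗ[ℝ] G (ι x)) (w : Σ x, E x) : Σ z, G z :=
  ⟨ι w.1, L w.1 w.2⟩

variable {ι : X → Z} {L : ∀ x, E x →ₗ[ℝ] G (ι x)}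

/-- A family of vectors that lifts along `totalMap ι L` can be replaced by `L (x t) (e t)` over the
base `ι (x t)`. -/
theorem eq_of_lift {n : ℕ} {b : Euc n → Z} {w : ∀ t, G (b t)} {q : Euc n → Σ x, E x}
    (h : (fun t ↦ (⟨b t, w t⟩ : Σ z, G z)) = totalMap ι L ∘ q)
    {P : ∀ b : Euc n → Z, (∀ t, G (b t)) → Prop}
    (hP : P (fun t ↦ ι (q t).1) (fun t ↦ L (q t).1 (q t).2)) : P b w := by
  obtain rfl : (fun t ↦ ι (q t).1) = b := funext fun t ↦ (congrArg Sigma.fst (congrFun h t)).symm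
  obtain rfl : (fun t ↦ L (q t).1 (q t).2) = w :=
    funext fun t ↦ (eq_of_heq (Sigma.mk.inj (congrFun h t)).2).symm
  exact hP

variable [DiffeologicalSpace X]

section VectorSpace

variable [DiffeologicalSpace (Σ x, E x)] [DiffeologicalSpace (Σ z, G z)]

theorem isPlot_smul_of_lift (hE : IsPseudoBundle E) (hL : DSmooth (totalMap ι L)) {n : ℕ}
    {b : Euc n → Z} {a : Euc n → ℝ} (ha : IsPlot a) {w : ∀ t, G (b t)} {q : Euc n → Σ x, E x}
    (hq : IsPlot q) (h : (fun t ↦ (⟨b t, w t⟩ : Σ z, G z)) = totalMap ι L ∘ q) :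
    IsPlot (fun t ↦ (⟨b t, a t • w t⟩ : Σ z, G z)) := by
  refine eq_of_lift h (P := fun b w ↦ IsPlot (fun t ↦ (⟨b t, a t • w t⟩ : Σ z, G z))) ?_
  simp only [← map_smul]
  exact hL n _ (hE.smul n _ a _ ha hq)

theorem isPlot_add_of_lift (hι : Function.Injective ι) (hE : IsPseudoBundle E)
    (hL : DSmooth (totalMap ι L)) {n : ℕ} {b : Euc n → Z} {w w' : ∀ t, G (b t)}
    {q q' : Euc n → Σ x, E x} (hq : IsPlot q) (hq' : IsPlot q')
    (h : (fun t ↦ (⟨b t, w t⟩ : Σ z, G z)) = totalMap ι L ∘ q)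
    (h' : (fun t ↦ (⟨b t, w' t⟩ : Σ z, G z)) = totalMap ι L ∘ q') :
    IsPlot (fun t ↦ (⟨b t, w t + w' t⟩ : Σ z, G z)) := by
  obtain ⟨x, e, rfl⟩ : ∃ (x : Euc n → X) (e : ∀ t, E (x t)), q = fun t ↦ ⟨x t, e t⟩ :=
    ⟨_, _, rfl⟩
  obtain ⟨x', e', rfl⟩ : ∃ (x : Euc n → X) (e : ∀ t, E (x t)), q' = fun t ↦ ⟨x t, e t⟩ :=
    ⟨_, _, rfl⟩
  -- The base points agree in `Z`, so they agree in `X` and the lifts can be added there.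
  obtain rfl : x = x' := funext fun t ↦ hι
    ((congrArg Sigma.fst (congrFun h t)).symm.trans (congrArg Sigma.fst (congrFun h' t)))
  obtain rfl : (fun t ↦ ι (x t)) = b :=
    funext fun t ↦ (congrArg Sigma.fst (congrFun h t)).symm
  obtain rfl : (fun t ↦ L (x t) (e t)) = w :=
    funext fun t ↦ (eq_of_heq (Sigma.mk.inj (congrFun h t)).2).symm
  obtain rfl : (fun t ↦ L (x t) (e' t)) = w' :=
    funext fun t ↦ (eq_of_heq (Sigma.mk.inj (congrFun h' t)).2).symm
  simp only [← map_add]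
  exact hL n _ (hE.add n x e e' hq hq')

end VectorSpace

/-! ### Transport of Clifford actions along fibrewise linear maps -/

variable [DiffeologicalSpace Z] (hι : DSmooth ι)
  {gX : ∀ x, LinearMap.BilinForm ℝ (Lam X x)} {gZ : ∀ z, LinearMap.BilinForm ℝ (Lam Z z)}
  (hg : ∀ x α β, gZ (ι x) α β = gX x (lamPullback ι hι rfl α) (lamPullback ι hι rfl β))

/-- The homomorphism of Clifford algebras induced by the pullback of covectors along `ι`. -/
def clPullback (x : X) : Cl gZ (ι x) →ₐ[ℝ] Cl gX x :=
  clLift (toCl gX x ∘ₗ lamPullback ι hι rfl) fun α ↦ by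
    rw [hg]
    exact toCl_mul_self gX x _

theorem clPullback_toCl (x : X) (α : Lam Z (ι x)) :
    clPullback hι hg x (toCl gZ (ι x) α) = toCl gX x (lamPullback ι hι rfl α) :=
  clLift_toCl _ _ α

theorem isPlot_clPullback {n : ℕ} {x : Euc n → X} (hx : IsPlot x) {k : ℕ} {a : Fin k → Euc n → ℝ}
    (ha : ∀ i, IsPlot (a i)) {r : Fin k → ℕ} {w : ∀ i, Fin (r i) → ∀ t, Lam Z (ι (x t))}
    (hw : ∀ i j, IsPlot (fun t ↦ (⟨ι (x t), w i j t⟩ : Σ z, Lam Z z))) :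
    IsPlot (fun t ↦ (⟨x t, clPullback hι hg (x t)
      (∑ i, a i t • (List.ofFn fun j ↦ toCl gZ (ι (x t)) (w i j t)).prod)⟩ : Σ x, Cl gX x)) := by
  refine DiffeologicalSpace.isPlot_generatedFrom_of_mem
    ⟨x, k, a, r, fun i j t ↦ lamPullback ι hι rfl (w i j t), hx, ha,
      fun i j ↦ isPlot_lamPullback hι hx (hw i j), funext fun t ↦ ?_⟩
  simp only [map_sum, map_smul, map_list_prod, List.map_ofFn, Function.comp_def, clPullback_toCl]

variable {cX : ∀ x, Cl gX x →ₐ[ℝ] Module.End ℝ (E x)}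
  {cZ : ∀ z, Cl gZ z →ₐ[ℝ] Module.End ℝ (G z)}

theorem clifford_intertwine (hι : DSmooth ι)
    (hg : ∀ x α β, gZ (ι x) α β = gX x (lamPullback ι hι rfl α) (lamPullback ι hι rfl β))
    (hc : ∀ x α e, cZ (ι x) (toCl gZ (ι x) α) (L x e) =
      L x (cX x (toCl gX x (lamPullback ι hι rfl α)) e))
    (x : X) (a : Cl gZ (ι x)) (e : E x) :
    cZ (ι x) a (L x e) = L x (cX x (clPullback hι hg x a) e) := by
  induction a using cl_induction generalizing e with
  | algebraMap a => simp [Module.algebraMap_end_apply]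
  | toCl α => rw [hc, clPullback_toCl]
  | mul a b iha ihb => simp only [map_mul, Module.End.mul_apply, iha, ihb]
  | add a b iha ihb => simp only [map_add, LinearMap.add_apply, iha, ihb]

variable [DiffeologicalSpace (Σ x, E x)] [DiffeologicalSpace (Σ z, G z)]

/-- A plot of a fibre of `G` that lifts to `E` lifts to a single fibre, as `ι` is injective. -/
theorem isPlot_fibre_action_of_lift (hι : DSmooth ι)
    (hg : ∀ x α β, gZ (ι x) α β = gX x (lamPullback ι hι rfl α) (lamPullback ι hι rfl β))
    (hc : ∀ x α e, cZ (ι x) (toCl gZ (ι x) α) (L x e) =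
      L x (cX x (toCl gX x (lamPullback ι hι rfl α)) e))
    (hinj : Function.Injective ι) (hcX : IsCliffordModule gX cX)
    (hL : DSmooth (totalMap ι L)) {z : Z} (a : Cl gZ z) {n : ℕ} {w : Euc n → G z}
    {q : Euc n → Σ x, E x} (hq : IsPlot q)
    (h : (fun t ↦ (⟨z, w t⟩ : Σ z, G z)) = totalMap ι L ∘ q) :
    IsPlot (fun t ↦ (⟨z, cZ z a (w t)⟩ : Σ z, G z)) := by
  obtain ⟨x, e, rfl⟩ : ∃ (x : Euc n → X) (e : ∀ t, E (x t)), q = fun t ↦ ⟨x t, e t⟩ :=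
    ⟨_, _, rfl⟩
  have hz : ∀ t, ι (x t) = z := fun t ↦ (congrArg Sigma.fst (congrFun h t)).symm
  obtain ⟨x₀, rfl⟩ : ∃ x₀, ι x₀ = z := ⟨_, hz 0⟩
  obtain rfl : (fun _ ↦ x₀) = x := funext fun t ↦ (hinj (hz t)).symm
  obtain rfl : (fun t ↦ L x₀ (e t)) = w :=
    funext fun t ↦ (eq_of_heq (Sigma.mk.inj (congrFun h t)).2).symm
  simp only [clifford_intertwine hι hg hc]
  obtain ⟨hfib, -⟩ := hcX.smooth
  exact hL n _ (hfib x₀ _ n e hq)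

theorem isPlot_action_of_lift (hι : DSmooth ι)
    (hg : ∀ x α β, gZ (ι x) α β = gX x (lamPullback ι hι rfl α) (lamPullback ι hι rfl β))
    (hc : ∀ x α e, cZ (ι x) (toCl gZ (ι x) α) (L x e) =
      L x (cX x (toCl gX x (lamPullback ι hι rfl α)) e))
    (hcX : IsCliffordModule gX cX)
    (hL : DSmooth (totalMap ι L)) {n : ℕ} {b : Euc n → Z} {k : ℕ} {a : Fin k → Euc n → ℝ}
    (ha : ∀ i, IsPlot (a i)) {r : Fin k → ℕ} {w : ∀ i, Fin (r i) → ∀ t, Lam Z (b t)}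
    (hw : ∀ i j, IsPlot (fun t ↦ (⟨b t, w i j t⟩ : Σ z, Lam Z z)))
    {u : ∀ t, G (b t)} {q : Euc n → Σ x, E x} (hq : IsPlot q)
    (h : (fun t ↦ (⟨b t, u t⟩ : Σ z, G z)) = totalMap ι L ∘ q) :
    IsPlot (fun t ↦ (⟨b t, cZ (b t)
      (∑ i, a i t • (List.ofFn fun j ↦ toCl gZ (b t) (w i j t)).prod) (u t)⟩ : Σ z, G z)) := by
  refine eq_of_lift h (P := fun b u ↦ ∀ w : ∀ i, Fin (r i) → ∀ t, Lam Z (b t),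
    (∀ i j, IsPlot (fun t ↦ (⟨b t, w i j t⟩ : Σ z, Lam Z z))) →
    IsPlot (fun t ↦ (⟨b t, cZ (b t)
      (∑ i, a i t • (List.ofFn fun j ↦ toCl gZ (b t) (w i j t)).prod) (u t)⟩ : Σ z, G z)))
    (fun w hw ↦ ?_) w hw
  simp only [clifford_intertwine hι hg hc]
  obtain ⟨hfib, hsmooth⟩ := hcX.smooth
  have hplot := hsmooth n _ (isPlot_clPullback hι hg (hcX.pseudoBundle.proj n q hq) ha hw)
  exact hL n _ (hplot.2 n id (fun t ↦ (q t).2) contDiff_id hq)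

end Along

/-! ### The induced action on the glued fibres -/

section GluedBundle

variable {X₁ : Type u₁} {X₂ : Type u₂} {Y : Set X₁} {f : Y → X₂}
  {E₁ : X₁ → Type v} [∀ x, AddCommGroup (E₁ x)] [∀ x, Module ℝ (E₁ x)]
  {E₂ : X₂ → Type v} [∀ x, AddCommGroup (E₂ x)] [∀ x, Module ℝ (E₂ x)]
  (F : ∀ y : Y, E₁ y.1 →ₗ[ℝ] E₂ (f y))

theorem exists_linearMap_totalInc₁ (x : X₁) :
    ∃ J : E₁ x →ₗ[ℝ] GlueFibre f F (inc₁ f x),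
      ∀ e, totalInc₁ f F ⟨x, e⟩ = ⟨inc₁ f x, J e⟩ := by
  by_cases hx : x ∈ Y
  · rw [show inc₁ f x = inc₂ f (f ⟨x, hx⟩) from inc₁_mem f ⟨x, hx⟩]
    exact ⟨F ⟨x, hx⟩, fun e ↦ totalInc₁_mem f F ⟨⟨x, e⟩, hx⟩⟩
  · rw [show inc₁ f x = .left ⟨x, hx⟩ from inc₁_notMem f ⟨x, hx⟩]
    exact ⟨LinearMap.id (M := E₁ x), fun e ↦ totalInc₁_notMem f F ⟨x, e⟩ hx⟩

/-- The restriction of `j̃₁` to the fibre over `x`, as a linear map. -/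
noncomputable def fibreInc₁ (x : X₁) : E₁ x →ₗ[ℝ] GlueFibre f F (inc₁ f x) :=
  (exists_linearMap_totalInc₁ F x).choose

/-- The restriction of `j₂` to the fibre over `x`, as a linear map; it is the identity. -/
noncomputable def fibreInc₂ (x : X₂) : E₂ x →ₗ[ℝ] GlueFibre f F (inc₂ f x) :=
  LinearMap.id (M := E₂ x)

theorem totalMap_fibreInc₁ : totalMap (inc₁ f) (fibreInc₁ F) = totalInc₁ f F :=
  funext fun w ↦ ((exists_linearMap_totalInc₁ F w.1).choose_spec w.2).symm

theorem totalMap_fibreInc₂ : totalMap (inc₂ f) (fibreInc₂ F) = totalInc₂ f F :=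
  rfl

section Algebra

variable {F} [DiffeologicalSpace X₁] [DiffeologicalSpace X₂]
  {g₁ : ∀ x, LinearMap.BilinForm ℝ (Lam X₁ x)} {g₂ : ∀ x, LinearMap.BilinForm ℝ (Lam X₂ x)}
  {c₁ : ∀ x, Cl g₁ x →ₐ[ℝ] Module.End ℝ (E₁ x)} {c₂ : ∀ x, Cl g₂ x →ₐ[ℝ] Module.End ℝ (E₂ x)}

theorem inducedAction_totalInc₁ (hc : CompatibleActions f F c₁ c₂) (w : Σ x, E₁ x)
    (α : Lam (Glue f) (totalInc₁ f F w).1) :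
    (⟨_, inducedAction f F c₁ c₂ _ α (totalInc₁ f F w).2⟩ : Σ z, GlueFibre f F z) =
      totalInc₁ f F ⟨w.1, c₁ w.1 (toCl g₁ w.1 (rho₁ f (totalInc₁_fst f F w) α)) w.2⟩ := by
  obtain ⟨x, e⟩ := w
  -- The point `j̃₁(e)` is generalised to `u`: its two descriptions live over different base points.
  have key : ∀ (u : Σ z, GlueFibre f F z) (_ : totalInc₁ f F ⟨x, e⟩ = u) (h : inc₁ f x = u.1)
      (α : Lam (Glue f) u.1),
      (⟨u.1, inducedAction f F c₁ c₂ _ α u.2⟩ : Σ z, GlueFibre f F z) =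
        totalInc₁ f F ⟨x, c₁ x (toCl g₁ x (rho₁ f h α)) e⟩ := by
    intro u hu h α
    by_cases hx : x ∈ Y
    · rw [totalInc₁_mem f F ⟨⟨x, e⟩, hx⟩] at hu
      subst hu
      rw [totalInc₁_mem f F ⟨⟨x, _⟩, hx⟩]
      exact congrArg (Sigma.mk (β := GlueFibre f F) (inc₂ f (f ⟨x, hx⟩))) (hc ⟨x, hx⟩ α e)
    · rw [totalInc₁_notMem f F ⟨x, e⟩ hx] at hu
      subst hu
      rw [totalInc₁_notMem f F ⟨x, _⟩ hx]
      rfl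
  exact key _ rfl _ α

/-- `fibreInc₁` intertwines `c₁` with the induced action, over `Y` as well. -/
theorem inducedAction_fibreInc₁ (hc : CompatibleActions f F c₁ c₂) (x : X₁)
    (α : Lam (Glue f) (inc₁ f x)) (e : E₁ x) :
    inducedAction f F c₁ c₂ (inc₁ f x) α (fibreInc₁ F x e) =
      fibreInc₁ F x (c₁ x (toCl g₁ x (rho₁ f rfl α)) e) := by
  have key : ∀ (u : Σ z, GlueFibre f F z) (_ : totalInc₁ f F ⟨x, e⟩ = u) (h : inc₁ f x = u.1)
      (α : Lam (Glue f) u.1),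
      (⟨u.1, inducedAction f F c₁ c₂ _ α u.2⟩ : Σ z, GlueFibre f F z) =
        totalInc₁ f F ⟨x, c₁ x (toCl g₁ x (rho₁ f h α)) e⟩ := by
    rintro _ rfl _ α
    exact inducedAction_totalInc₁ hc ⟨x, e⟩ α
  have := key ⟨inc₁ f x, fibreInc₁ F x e⟩ (congrFun (totalMap_fibreInc₁ F) ⟨x, e⟩).symm rfl α
  rw [← totalMap_fibreInc₁] at this
  exact eq_of_heq (Sigma.mk.inj this).2

/-- The induced action as a linear map in the covector. -/
noncomputable def inducedActionLinear (F : ∀ y : Y, E₁ y.1 →ₗ[ℝ] E₂ (f y))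
    (c₁ : ∀ x, Cl g₁ x →ₐ[ℝ] Module.End ℝ (E₁ x)) (c₂ : ∀ x, Cl g₂ x →ₐ[ℝ] Module.End ℝ (E₂ x))
    (z : Glue f) : Lam (Glue f) z →ₗ[ℝ] Module.End ℝ (GlueFibre f F z) where
  toFun := inducedAction f F c₁ c₂ z
  map_add' α β := by
    obtain x | x := z
    · exact map_add ((c₁ x.1).toLinearMap ∘ₗ toCl g₁ x.1 ∘ₗ rho₁ f (inc₁_notMem f x)) α β
    · exact map_add ((c₂ x).toLinearMap ∘ₗ toCl g₂ x ∘ₗ rho₂ f rfl) α β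
  map_smul' a α := by
    obtain x | x := z
    · exact map_smul ((c₁ x.1).toLinearMap ∘ₗ toCl g₁ x.1 ∘ₗ rho₁ f (inc₁_notMem f x)) a α
    · exact map_smul ((c₂ x).toLinearMap ∘ₗ toCl g₂ x ∘ₗ rho₂ f rfl) a α

theorem inducedAction_mul_self (hf : DSmooth f) (hg : CompatibleMetrics hf g₁ g₂) (z : Glue f)
    (α : Lam (Glue f) z) :
    inducedAction f F c₁ c₂ z α * inducedAction f F c₁ c₂ z α =
      algebraMap ℝ (Module.End ℝ (GlueFibre f F z)) (-(gluedMetric f g₁ g₂ z α α)) := by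
  obtain x | x := z
  · have h := congrArg (c₁ x.1) (toCl_mul_self g₁ x.1 (rho₁ f (inc₁_notMem f x) α))
    rw [map_mul, AlgHom.commutes] at h
    exact h
  · have h := congrArg (c₂ x) (toCl_mul_self g₂ x (rho₂ f rfl α))
    rw [map_mul, AlgHom.commutes] at h
    exact h.trans (congrArg (fun a ↦ algebraMap ℝ (Module.End ℝ (E₂ x)) (-a))
      (gluedMetric_inc₂ hf hg (x := x) rfl α α).symm)

end Algebra

/-! ### The glued pseudo-bundle and its Clifford module structure -/

variable [DiffeologicalSpace (Σ x, E₁ x)] [DiffeologicalSpace (Σ x, E₂ x)]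

theorem smooth_totalMap_fibreInc₁ : DSmooth (totalMap (inc₁ f) (fibreInc₁ F)) := by
  rw [totalMap_fibreInc₁]
  exact smooth_pushforward _ _ le_sup_left

theorem smooth_totalMap_fibreInc₂ : DSmooth (totalMap (inc₂ f) (fibreInc₂ F)) :=
  smooth_pushforward _ _ le_sup_right

theorem exists_local_lift_total {n : ℕ} {w : Euc n → Σ z, GlueFibre f F z} (hw : IsPlot w)
    (s : Euc n) : ∃ r, IsLocalIdentity s r ∧
      ((∃ q : Euc n → Σ x, E₁ x, IsPlot q ∧ w ∘ r = totalMap (inc₁ f) (fibreInc₁ F) ∘ q) ∨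
        ∃ q : Euc n → Σ x, E₂ x, IsPlot q ∧ w ∘ r = totalMap (inc₂ f) (fibreInc₂ F) ∘ q) := by
  rw [totalMap_fibreInc₁, totalMap_fibreInc₂]
  exact exists_local_lift (totalGlue_surjective f F) hw s

variable {F}

/-- A plot of `E₁` lying over `Y` can be moved to `E₂` by the gluing map. -/
theorem exists_lift₂_of_lift₁ (hF : DSmooth (coveringMap f F)) {n : ℕ}
    {q : Euc n → Σ x, E₁ x} (hq : IsPlot q) (hY : ∀ t, (q t).1 ∈ Y) :
    ∃ q' : Euc n → Σ x, E₂ x, IsPlot q' ∧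
      totalMap (inc₁ f) (fibreInc₁ F) ∘ q = totalMap (inc₂ f) (fibreInc₂ F) ∘ q' := by
  rw [totalMap_fibreInc₁, totalMap_fibreInc₂]
  exact ⟨fun t ↦ coveringMap f F ⟨q t, hY t⟩, hF n (fun t ↦ ⟨q t, hY t⟩) hq,
    funext fun t ↦ totalInc₁_mem f F ⟨q t, hY t⟩⟩

/-- Two plots over the same base lift locally to the same one of the two pseudo-bundles. -/
theorem exists_local_common_lift (hF : DSmooth (coveringMap f F)) {n : ℕ}
    {w w' : Euc n → Σ z, GlueFibre f F z} (hw : IsPlot w) (hw' : IsPlot w')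
    (hb : ∀ t, (w t).1 = (w' t).1) (s : Euc n) : ∃ r, IsLocalIdentity s r ∧
      ((∃ q q' : Euc n → Σ x, E₁ x, IsPlot q ∧ IsPlot q' ∧
          w ∘ r = totalMap (inc₁ f) (fibreInc₁ F) ∘ q ∧
          w' ∘ r = totalMap (inc₁ f) (fibreInc₁ F) ∘ q') ∨
        ∃ q q' : Euc n → Σ x, E₂ x, IsPlot q ∧ IsPlot q' ∧
          w ∘ r = totalMap (inc₂ f) (fibreInc₂ F) ∘ q ∧
          w' ∘ r = totalMap (inc₂ f) (fibreInc₂ F) ∘ q') := by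
  obtain ⟨r, hr, h⟩ := exists_local_lift_total F hw s
  obtain ⟨r', hr', h'⟩ := exists_local_lift_total F (isPlot_reparam hw' hr.1) s
  refine ⟨r ∘ r', hr.comp hr', ?_⟩
  have hbase : ∀ {q₁ : Euc n → Σ x, E₁ x} {q₂ : Euc n → Σ x, E₂ x} {u u' : Euc n → Σ z, _},
      (∀ t, (u t).1 = (u' t).1) → u = totalMap (inc₁ f) (fibreInc₁ F) ∘ q₁ →
      u' = totalMap (inc₂ f) (fibreInc₂ F) ∘ q₂ → ∀ t, (q₁ t).1 ∈ Y := by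
    rintro q₁ q₂ _ _ h rfl rfl t
    exact ((inc₁_eq_inc₂_iff f).1 (h t)).1
  have h : (∃ q : Euc n → Σ x, E₁ x, IsPlot q ∧
        w ∘ (r ∘ r') = totalMap (inc₁ f) (fibreInc₁ F) ∘ q) ∨
      ∃ q : Euc n → Σ x, E₂ x, IsPlot q ∧ w ∘ (r ∘ r') = totalMap (inc₂ f) (fibreInc₂ F) ∘ q :=
    h.imp (fun ⟨q, hq, h⟩ ↦ ⟨q ∘ r', isPlot_reparam hq hr'.1, congrArg (· ∘ r') h⟩)
      (fun ⟨q, hq, h⟩ ↦ ⟨q ∘ r', isPlot_reparam hq hr'.1, congrArg (· ∘ r') h⟩)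
  obtain ⟨q, hq, h⟩ | ⟨q, hq, h⟩ := h <;> obtain ⟨q', hq', h'⟩ | ⟨q', hq', h'⟩ := h'
  · exact Or.inl ⟨q, q', hq, hq', h, h'⟩
  · obtain ⟨q₂, hq₂, h₂⟩ :=
      exists_lift₂_of_lift₁ hF hq (hbase (fun t ↦ hb (r (r' t))) h h')
    exact Or.inr ⟨q₂, q', hq₂, hq', h.trans h₂, h'⟩
  · obtain ⟨q₂, hq₂, h₂⟩ :=
      exists_lift₂_of_lift₁ hF hq' (hbase (fun t ↦ (hb (r (r' t))).symm) h' h)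
    exact Or.inr ⟨q, q₂, hq, hq₂, h, h'.trans h₂⟩
  · exact Or.inr ⟨q, q', hq, hq', h, h'⟩

variable [DiffeologicalSpace X₁] [DiffeologicalSpace X₂]

theorem isPseudoBundle_glue (hinj : Function.Injective f) (hF : DSmooth (coveringMap f F))
    (hE₁ : IsPseudoBundle E₁) (hE₂ : IsPseudoBundle E₂) :
    IsPseudoBundle (GlueFibre f F) where
  proj n w hw := isPlot_of_local fun s ↦ by
    obtain ⟨r, hr, ⟨q, hq, h⟩ | ⟨q, hq, h⟩⟩ := exists_local_lift_total F hw s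
    · refine ⟨r, hr, ?_⟩
      rw [Function.comp_assoc, h]
      exact smooth_inc₁ f n _ (hE₁.proj n q hq)
    · refine ⟨r, hr, ?_⟩
      rw [Function.comp_assoc, h]
      exact smooth_inc₂ f n _ (hE₂.proj n q hq)
  add n b w w' hw hw' := isPlot_of_local fun s ↦ by
    obtain ⟨r, hr, ⟨q, q', hq, hq', h, h'⟩ | ⟨q, q', hq, hq', h, h'⟩⟩ :=
      exists_local_common_lift hF hw hw' (fun _ ↦ rfl) s
    · exact ⟨r, hr, isPlot_add_of_lift (inc₁_injective hinj) hE₁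
        (smooth_totalMap_fibreInc₁ F) hq hq' h h'⟩
    · exact ⟨r, hr, isPlot_add_of_lift (inc₂_injective f) hE₂
        (smooth_totalMap_fibreInc₂ F) hq hq' h h'⟩
  smul n b a w ha hw := isPlot_of_local fun s ↦ by
    obtain ⟨r, hr, ⟨q, hq, h⟩ | ⟨q, hq, h⟩⟩ := exists_local_lift_total F hw s
    · exact ⟨r, hr, isPlot_smul_of_lift hE₁ (smooth_totalMap_fibreInc₁ F)
        (isPlot_reparam ha hr.1) hq h⟩
    · exact ⟨r, hr, isPlot_smul_of_lift hE₂ (smooth_totalMap_fibreInc₂ F)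
        (isPlot_reparam ha hr.1) hq h⟩
  zero n p hp := isPlot_of_local fun s ↦ by
    obtain ⟨r, hr, ⟨q, hq, h⟩ | ⟨q, hq, h⟩⟩ := exists_local_lift (glue_surjective f) hp s
    · refine ⟨r, hr, ?_⟩
      rw [Function.comp_assoc, h]
      have := smooth_totalMap_fibreInc₁ F n _ (hE₁.zero n q hq)
      simpa only [Function.comp_def, totalMap, map_zero] using this
    · refine ⟨r, hr, ?_⟩
      rw [Function.comp_assoc, h]
      have := smooth_totalMap_fibreInc₂ F n _ (hE₂.zero n q hq)
      simpa only [Function.comp_def, totalMap, map_zero] using this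

variable {g₁ : ∀ x, LinearMap.BilinForm ℝ (Lam X₁ x)} {g₂ : ∀ x, LinearMap.BilinForm ℝ (Lam X₂ x)}
  {c₁ : ∀ x, Cl g₁ x →ₐ[ℝ] Module.End ℝ (E₁ x)} {c₂ : ∀ x, Cl g₂ x →ₐ[ℝ] Module.End ℝ (E₂ x)}

theorem isCliffordModule_glue (hf : DSmooth f) (hinj : Function.Injective f)
    (hg : CompatibleMetrics hf g₁ g₂) (hc₁ : IsCliffordModule g₁ c₁)
    (hc₂ : IsCliffordModule g₂ c₂) (hF : DSmooth (coveringMap f F))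
    (hc : CompatibleActions f F c₁ c₂)
    {c : ∀ z, Cl (gluedMetric f g₁ g₂) z →ₐ[ℝ] Module.End ℝ (GlueFibre f F z)}
    (hcz : ∀ z α, c z (toCl (gluedMetric f g₁ g₂) z α) = inducedAction f F c₁ c₂ z α) :
    IsCliffordModule (gluedMetric f g₁ g₂) c := by
  have hE := isPseudoBundle_glue hinj hF hc₁.pseudoBundle hc₂.pseudoBundle
  have hact₁ : ∀ x α e, c (inc₁ f x) (toCl _ (inc₁ f x) α) (fibreInc₁ F x e) =
      fibreInc₁ F x (c₁ x (toCl g₁ x (lamPullback (inc₁ f) (smooth_inc₁ f) rfl α)) e) :=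
    fun x α e ↦ by rw [hcz]; exact inducedAction_fibreInc₁ hc x α e
  have hact₂ : ∀ x α e, c (inc₂ f x) (toCl _ (inc₂ f x) α) (fibreInc₂ F x e) =
      fibreInc₂ F x (c₂ x (toCl g₂ x (lamPullback (inc₂ f) (smooth_inc₂ f) rfl α)) e) :=
    fun x α e ↦ by rw [hcz]; rfl
  have hg₁ := fun x α β ↦ gluedMetric_inc₁ hf hg (x := x) rfl α β
  have hg₂ := fun x α β ↦ gluedMetric_inc₂ hf hg (x := x) rfl α β
  have hfib : ∀ z a, @DSmooth _ _ (fibreDiffeology (GlueFibre f F) z)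
      (fibreDiffeology (GlueFibre f F) z) (c z a) := by
    intro z a n w hw
    change IsPlot (fun t ↦ (⟨z, c z a (w t)⟩ : Σ z, GlueFibre f F z))
    refine isPlot_of_local fun s ↦ ?_
    obtain ⟨r, hr, ⟨q, hq, h⟩ | ⟨q, hq, h⟩⟩ := exists_local_lift_total F hw s
    · exact ⟨r, hr, isPlot_fibre_action_of_lift (smooth_inc₁ f) hg₁ hact₁ (inc₁_injective hinj)
        hc₁ (smooth_totalMap_fibreInc₁ F) a hq h⟩
    · exact ⟨r, hr, isPlot_fibre_action_of_lift (smooth_inc₂ f) hg₂ hact₂ (inc₂_injective f)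
        hc₂ (smooth_totalMap_fibreInc₂ F) a hq h⟩
  refine ⟨hE, hfib, dSmooth_generateFrom ?_⟩
  rintro n p ⟨b, k, a, l, w, hb, ha, hw, hp⟩
  rw [show p = _ from hp]
  refine ⟨hb, fun m u e hu he ↦ isPlot_of_local fun s ↦ ?_⟩
  obtain ⟨r, hr, ⟨q, hq, h⟩ | ⟨q, hq, h⟩⟩ := exists_local_lift_total F he s
  · exact ⟨r, hr, isPlot_action_of_lift (smooth_inc₁ f) hg₁ hact₁ hc₁
      (smooth_totalMap_fibreInc₁ F) (fun i ↦ isPlot_reparam (ha i) (hu.comp hr.1))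
      (fun i j ↦ isPlot_reparam (hw i j) (hu.comp hr.1)) hq h⟩
  · exact ⟨r, hr, isPlot_action_of_lift (smooth_inc₂ f) hg₂ hact₂ hc₂
      (smooth_totalMap_fibreInc₂ F) (fun i ↦ isPlot_reparam (ha i) (hu.comp hr.1))
      (fun i j ↦ isPlot_reparam (hw i j) (hu.comp hr.1)) hq h⟩

end GluedBundle

end DiffGluing

theorem mainTheorem3
    {X₁ : Type u₁} {X₂ : Type u₂} [DiffeologicalSpace X₁] [DiffeologicalSpace X₂]
    (hfin₁ : ∀ x, FiniteDimensional ℝ (Lam X₁ x)) (hfin₂ : ∀ x, FiniteDimensional ℝ (Lam X₂ x))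
    {Y : Set X₁} (f : Y → X₂) (hf : IsDiffeoOntoImage f) (hD : EqualFormDiffeologies hf.smooth)
    (g₁ : ∀ x, LinearMap.BilinForm ℝ (Lam X₁ x)) (g₂ : ∀ x, LinearMap.BilinForm ℝ (Lam X₂ x))
    (hg₁ : IsPseudoMetric g₁) (hg₂ : IsPseudoMetric g₂)
    (hg : CompatibleMetrics hf.smooth g₁ g₂)
    {E₁ : X₁ → Type v} [∀ x, AddCommGroup (E₁ x)] [∀ x, Module ℝ (E₁ x)]
    [DiffeologicalSpace (Σ x, E₁ x)]
    {E₂ : X₂ → Type v} [∀ x, AddCommGroup (E₂ x)] [∀ x, Module ℝ (E₂ x)]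
    [DiffeologicalSpace (Σ x, E₂ x)]
    (c₁ : ∀ x, Cl g₁ x →ₐ[ℝ] Module.End ℝ (E₁ x)) (hc₁ : IsCliffordModule g₁ c₁)
    (c₂ : ∀ x, Cl g₂ x →ₐ[ℝ] Module.End ℝ (E₂ x)) (hc₂ : IsCliffordModule g₂ c₂)
    (F : ∀ y : Y, E₁ y.1 →ₗ[ℝ] E₂ (f y)) (hF : IsDiffeoOntoImage (coveringMap f F))
    (hc : CompatibleActions f F c₁ c₂) :
    -- `g^Λ` is a pseudo-metric
    IsPseudoMetric (gluedMetric f g₁ g₂) ∧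
    -- `c̃` does not depend on the representative in `E₁` or `E₂` used to compute it
    (∀ (w : Σ x, E₁ x) (α : Lam (Glue f) (totalInc₁ f F w).1),
      (⟨_, inducedAction f F c₁ c₂ _ α (totalInc₁ f F w).2⟩ : Σ z, GlueFibre f F z) =
        totalInc₁ f F ⟨w.1, c₁ w.1 (toCl g₁ w.1 (rho₁ f (totalInc₁_fst f F w) α)) w.2⟩) ∧
    (∀ (w : Σ x, E₂ x) (α : Lam (Glue f) (totalInc₂ f F w).1),
      (⟨_, inducedAction f F c₁ c₂ _ α (totalInc₂ f F w).2⟩ : Σ z, GlueFibre f F z) =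
        totalInc₂ f F ⟨w.1, c₂ w.1 (toCl g₂ w.1 (rho₂ f rfl α)) w.2⟩) ∧
    -- `c̃` extends, uniquely, to a smooth Clifford action of `Cl(Λ¹(X₁ ∪_f X₂), g^Λ)`
    ∃ c : ∀ z, Cl (gluedMetric f g₁ g₂) z →ₐ[ℝ] Module.End ℝ (GlueFibre f F z),
      (∀ z α, c z (toCl (gluedMetric f g₁ g₂) z α) = inducedAction f F c₁ c₂ z α) ∧
      IsCliffordModule (gluedMetric f g₁ g₂) c ∧
      ∀ c' : ∀ z, Cl (gluedMetric f g₁ g₂) z →ₐ[ℝ] Module.End ℝ (GlueFibre f F z),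
        (∀ z α, c' z (toCl (gluedMetric f g₁ g₂) z α) = inducedAction f F c₁ c₂ z α) →
        c' = c := by
  refine ⟨isPseudoMetric_gluedMetric hfin₁ hfin₂ hf.smooth hf.injective hg₁ hg₂ hg,
    inducedAction_totalInc₁ hc, fun _ _ ↦ rfl,
    fun z ↦ clLift (inducedActionLinear F c₁ c₂ z) (inducedAction_mul_self hf.smooth hg z),
    fun z α ↦ clLift_toCl _ _ α,
    isCliffordModule_glue hf.smooth hf.injective hg hc₁ hc₂ hF.smooth hc
      fun z α ↦ clLift_toCl _ _ α,
    fun c' hc' ↦ funext fun z ↦ cl_algHom_ext fun α ↦ ?_⟩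
  exact (hc' z α).trans
    (clLift_toCl (inducedActionLinear F c₁ c₂ z) (inducedAction_mul_self hf.smooth hg z) α).symm
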